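/- Let $\mathbb T^3=\mathbb R^3/\mathbb Z^3$ carry the flat (Euclidean) metric and the Lebesgue probability measure $\mu$. For a bi-Lipschitz homeomorphism $\phi$ of $\mathbb T^3$ let $\Gamma(\phi)$ be the maximum of the Lipschitz constants of $\phi$ and $\phi^{-1}$, and put $\widehat\Gamma_n(\phi)=\max_{1\le i\le n}\Gamma(\phi^i)$. Let $u:[0,\infty)\to[0,\infty)$ be a concave increasing function with $\lim_{x\to\infty}u(x)=\infty$, $u(1)\ge 1$ and $u(x)\le x^{3/4}$ for all $x\ge 1$ (so $u(1)=1$, and $u(n)>1$ for every integer $n\ge 2$). Then there is a real-analytic, $\mu$-preserving diffeomorphism $\phi:\mathbb T^3\to\mathbb T^3$, which is a skew product $\phi(x,y,z)=(x+\alpha,\,y+\beta,\,z+h(x,y))$ with $\alpha,\beta\in\mathbb R/\mathbb Z$ and $h:\mathbb T^2\to\mathbb R$ real-analytic, such that: (i) $\phi$ mixes a nonzero real-analytic function at the rate $\log u(n)/u(n)^{1/3}$: there is a real-analytic $f:\mathbb T^3\to\mathbb R$, $f\not\equiv 0$, with $\int f\,d\mu=0$ and $$\Big|\int_{\mathbb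 T^3} (f\circ\phi^n)\, f\,d\mu\Big|\le \frac{\log u(n)}{u(n)^{1/3}}\quad\text{for every } n\ge 1,$$ where the right-hand side tends to $0$ as $n\to\infty$. (ii) There is a constant $c_1>0$ such that $\Gamma(\phi^n)\le c_1u(n)$ for infinitely many $n\in\mathbb N$. (iii) There are constants $c_2,c_3>0$ such that $$c_2\,\frac{\sqrt n}{\log u(n)}\le\widehat\Gamma_n(\phi)\quad\text{for every } n\ge 2,\qquad \widehat\Gamma_n(\phi)\le c_3\,u(\sqrt n)\,\sqrt n\quad\text{for infinitely many } n.$$ -/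

import Mathlib

open Set Filter Topology MeasureTheory

noncomputable section

/-! ### Growth and mixing on a metric measure space -/

/-- The Lipschitz constant of a map between metric spaces, with value `∞` if the map is not
Lipschitz: the supremum of `ρ (f x, f y) / ρ (x, y)` over all pairs of distinct points. -/
def lipConst {X Y : Type*} [MetricSpace X] [MetricSpace Y] (f : X → Y) : ENNReal :=
  ⨆ (x : X) (y : X) (_ : x ≠ y), edist (f x) (f y) / edist x y

/-- `Γ(φ)`: the maximum of the Lipschitz constants of `φ` and of its inverse. -/
def growth {M : Type*} [MetricSpace M] (φ : Equiv.Perm M) : ENNReal :=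
  max (lipConst φ) (lipConst φ.symm)

/-- `Γ̂ₙ(φ)`: the maximum of `Γ(φ^i)` over `1 ≤ i ≤ n`. -/
def maxGrowth {M : Type*} [MetricSpace M] (φ : Equiv.Perm M) (n : ℕ) : ENNReal :=
  (Finset.Icc 1 n).sup fun i => growth (φ ^ i)

/-- `φ` mixes the Lipschitz function `f` of zero mean at the rate `a 1, a 2, …`, where `a n → 0`. -/
structure MixesAtRate {M : Type*} [MetricSpace M] [MeasurableSpace M] (μ : Measure M)
    (φ : Equiv.Perm M) (f : M → ℝ) (a : ℕ → ℝ) : Prop where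
  lipschitz : ∃ K : NNReal, LipschitzWith K f
  mean_zero : ∫ x, f x ∂μ = 0
  rate_tendsto : Tendsto a atTop (𝓝 0)
  bound : ∀ n : ℕ, 1 ≤ n → |∫ x, f ((φ ^ n) x) * f x ∂μ| ≤ a n

/-! ### The flat torus `ℝ^d / ℤ^d` -/

/-- The torus `ℝ^d / ℤ^d` with the metric induced by the Euclidean metric of `ℝ^d`, that is
`ρ (x, y) = (∑ i, ‖x i - y i‖ ^ 2) ^ (1 / 2)`, where `‖t‖` is the distance of `t` to `ℤ`. -/
abbrev FlatTorus (d : ℕ) : Type := PiLp 2 (fun _ : Fin d => UnitAddCircle)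

/-- Lebesgue measure on the torus (the product of the `d` Lebesgue probability measures). -/
def torusMeasure (d : ℕ) : Measure (FlatTorus d) :=
  Measure.map (WithLp.toLp 2) (volume : Measure (UnitAddTorus (Fin d)))

/-- The covering map `ℝ^d → ℝ^d / ℤ^d`. -/
def torusProj (d : ℕ) (x : EuclideanSpace ℝ (Fin d)) : FlatTorus d :=
  WithLp.toLp 2 fun i => (x i : UnitAddCircle)

/-- A real function on the torus is real-analytic if its pull-back to `ℝ^d` is. -/
def IsAnalyticFun {d : ℕ} (f : FlatTorus d → ℝ) : Prop :=
  AnalyticOnNhd ℝ (fun x => f (torusProj d x)) univ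

/-- A self-map of the torus is real-analytic if it lifts to a real-analytic map of `ℝ^d`. -/
def IsAnalyticMap {d : ℕ} (φ : FlatTorus d → FlatTorus d) : Prop :=
  ∃ Φ : EuclideanSpace ℝ (Fin d) → EuclideanSpace ℝ (Fin d),
    AnalyticOnNhd ℝ Φ univ ∧ ∀ x, torusProj d (Φ x) = φ (torusProj d x)

/-- A real-analytic diffeomorphism of the torus. -/
def IsAnalyticDiffeo {d : ℕ} (φ : Equiv.Perm (FlatTorus d)) : Prop :=
  IsAnalyticMap φ ∧ IsAnalyticMap φ.symm

/-- A real-analytic skew product on the `3`-torus over a rotation of the `2`-torus: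
`φ (x, y, z) = (x + α, y + β, z + h (x, y))`. -/
def IsSkewProduct (φ : FlatTorus 3 → FlatTorus 3) : Prop :=
  ∃ (α β : UnitAddCircle) (h : FlatTorus 2 → ℝ), IsAnalyticFun h ∧
    ∀ p : FlatTorus 3,
      φ p = WithLp.toLp 2
        ![p 0 + α, p 1 + β, p 2 + ((h (WithLp.toLp 2 ![p 0, p 1]) : ℝ) : UnitAddCircle)]

end

/-! Construction. The cocycle is h(x,y) = X(x) + Y(y). Here X is the sum over even j of A_j cos(2π
q_j x), Y is the same sum over odd j in the variable y, and A_j = u(n_j)/(q_j n_j), with times n_j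
so sparse that u(n_{j+1}) ≥ exp(100 n_j²). The rotation numbers are α = ∑ 1/q_{2i} and β = ∑
1/q_{2i+1}. Since q_{j+2} = q_j n_{j+1}, q_j times the rotation number of its parity exceeds an
integer by about 1/n_{j+1}. So the j-th rotation sum grows linearly up to time n_{j+1}/4, never
exceeds n_{j+1}, and is bounded again at time n_{j+1} (`le_norm_rotSum_q`, `norm_rotSum_le_n`,
`norm_rotSum_at_n_le`). As u(x) ≤ x^{3/4}, A_{j+1} ≤ exp(-33 n_j²), while q_{j+1} ≤ n_j²; hence h is
analytic.

Mixing. Let n_{l+1} ≤ 4m ≤ n_{l+2}. By concavity the (l+1)-st term of the m-th Birkhoff sum has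
amplitude at least of order u(m)/q_{l+1}. The neighbours l and l+2, which could compete with it,
have the other parity and live in the other variable; this is why the base is two-dimensional. The
other terms of the same parity are O(n_l), and q_{l+1} ≤ n_l² ≤ log u(m). An oscillatory integral
whose phase has one dominating term of amplitude B is O(B^{-1/3})
(`norm_integral_phase_trigSum_le`), which gives the rate (`norm_integral_phase_birkhoff_le`); the
integral in the other variable is bounded by 1.

Observable. At time 1 the required bound is 0, so the correlation must vanish exactly. All q_j are
divisible by 3, so for f = ε(A + √2 cos 2πx) cos 2πz only the factor A² + cos 2πmα survives in the
correlation (`integral_autocorrelation`). As α is close to 1/3, A² = -cos 2πα is possible and kills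
time 1; a small ε absorbs the constant in the rate.

Growth. It is governed by the derivatives of the Birkhoff sums. At time n_k the (k-1)-st term has
returned and the k-th has derivative u(n_k); up to time n_k² the k-th term has derivative at most
u(n_k) n_k. For the lower bound one evaluates a dominating term at a suitable time m ≤ N. -/

/-! ### Phases and rotation sums -/

/-- The unit complex number `exp (2 π i t)`. -/
noncomputable def phase (t : ℝ) : ℂ := Complex.exp (Complex.I * ((2 * Real.pi * t : ℝ) : ℂ))

theorem phase_add (s t : ℝ) : phase (s + t) = phase s * phase t := by
  rw [phase, phase, phase, ← Complex.exp_add]; congr 1; push_cast; ring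

@[simp] theorem phase_zero : phase 0 = 1 := by simp [phase]

@[simp] theorem norm_phase (t : ℝ) : ‖phase t‖ = 1 := Complex.norm_exp_I_mul_ofReal _

theorem phase_re (t : ℝ) : (phase t).re = Real.cos (2 * Real.pi * t) := by
  rw [phase, mul_comm]; exact Complex.exp_ofReal_mul_I_re _

@[simp] theorem phase_intCast (m : ℤ) : phase m = 1 := by
  rw [phase, Complex.exp_eq_one_iff]; exact ⟨m, by push_cast; ring⟩

theorem phase_add_intCast (t : ℝ) (m : ℤ) : phase (t + m) = phase t := by
  rw [phase_add, phase_intCast, mul_one]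

theorem phase_nat_mul (n : ℕ) (t : ℝ) : phase (n * t) = phase t ^ n := by
  rw [phase, phase, ← Complex.exp_nat_mul]; congr 1; push_cast; ring

theorem norm_phase_sub_one (t : ℝ) : ‖phase t - 1‖ = 2 * |Real.sin (Real.pi * t)| := by
  rw [phase, Complex.norm_exp_I_mul_ofReal_sub_one, Real.norm_eq_abs, abs_mul, abs_two]
  congr 3; ring

theorem norm_phase_sub_one_le (t : ℝ) : ‖phase t - 1‖ ≤ 2 * Real.pi * |t| := by
  rw [norm_phase_sub_one]
  have h := Real.abs_sin_le_abs (x := Real.pi * t)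
  rw [abs_mul, abs_of_pos Real.pi_pos] at h
  linarith

theorem le_norm_phase_sub_one {t : ℝ} (ht : |t| ≤ 1 / 2) : 4 * |t| ≤ ‖phase t - 1‖ := by
  rw [norm_phase_sub_one]
  have hpi := Real.pi_pos
  have h : |Real.pi * t| ≤ Real.pi / 2 := by rw [abs_mul, abs_of_pos hpi]; nlinarith
  have h2 := Real.mul_abs_le_abs_sin h
  rw [abs_mul, abs_of_pos hpi] at h2
  have h3 : 2 / Real.pi * (Real.pi * |t|) = 2 * |t| := by field_simp
  linarith

theorem hasDerivAt_phase_comp {f : ℝ → ℝ} {f' x : ℝ} (hf : HasDerivAt f f' x) :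
    HasDerivAt (fun y => phase (f y)) (phase (f x) * (Complex.I * ((2 * Real.pi * f' : ℝ) : ℂ))) x := by
  unfold phase
  exact (((hf.const_mul (2 * Real.pi)).ofReal_comp).const_mul Complex.I).cexp

theorem continuous_phase : Continuous phase := by unfold phase; fun_prop

/-- The sum of the phases of the first `n` points of the orbit of `0` under rotation by `θ`. -/
noncomputable def rotSum (θ : ℝ) (n : ℕ) : ℂ := ∑ j ∈ Finset.range n, phase (j * θ)

theorem rotSum_mul_phase_sub_one (θ : ℝ) (n : ℕ) :
    rotSum θ n * (phase θ - 1) = phase (n * θ) - 1 := by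
  simp only [rotSum, phase_nat_mul]; exact geom_sum_mul _ _

theorem rotSum_add_intCast (θ : ℝ) (m : ℤ) (n : ℕ) : rotSum (θ + m) n = rotSum θ n := by
  refine Finset.sum_congr rfl fun j _ => ?_
  rw [mul_add, show (j : ℝ) * (m : ℝ) = ((j * m : ℤ) : ℝ) by push_cast; ring, phase_add_intCast]

theorem norm_rotSum_le (θ : ℝ) (n : ℕ) : ‖rotSum θ n‖ ≤ n := by
  refine (norm_sum_le _ _).trans ?_
  simp

/-- In the closed form of the geometric sum the numerator is small when `n * θ` is close to an
integer. It is applied with `m = 1`, at the first return. -/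
theorem norm_rotSum_le_near_integer {θ : ℝ} (h0 : 0 < θ) (h1 : θ ≤ 1 / 2) (n : ℕ) (m : ℤ) :
    ‖rotSum θ n‖ ≤ Real.pi * |n * θ - m| / (2 * θ) := by
  have h := congrArg norm (rotSum_mul_phase_sub_one θ n)
  have e : phase (n * θ) = phase (n * θ - m) := by
    rw [← phase_add_intCast (n * θ - m) m, sub_add_cancel]
  rw [norm_mul, e] at h
  have h2 := norm_phase_sub_one_le (n * θ - m)
  have h3 := le_norm_phase_sub_one (t := θ) (by rwa [abs_of_pos h0])
  rw [abs_of_pos h0] at h3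
  rw [le_div_iff₀ (by positivity)]
  nlinarith [norm_nonneg (rotSum θ n)]

theorem norm_rotSum_le_inv {θ : ℝ} (h0 : 0 < θ) (h1 : θ ≤ 1 / 2) (n : ℕ) :
    ‖rotSum θ n‖ ≤ 1 / (2 * θ) := by
  have h := congrArg norm (rotSum_mul_phase_sub_one θ n)
  rw [norm_mul] at h
  have h2 : ‖phase (n * θ) - 1‖ ≤ 2 := by
    refine (norm_sub_le _ _).trans ?_
    rw [norm_phase, norm_one]; norm_num
  have h3 := le_norm_phase_sub_one (t := θ) (by rwa [abs_of_pos h0])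
  rw [abs_of_pos h0] at h3
  rw [le_div_iff₀ (by positivity)]
  nlinarith [norm_nonneg (rotSum θ n)]

theorem le_norm_rotSum {θ : ℝ} (h0 : 0 < θ) {n : ℕ} (h1 : n * θ ≤ 1 / 2) :
    2 * n / Real.pi ≤ ‖rotSum θ n‖ := by
  have h := congrArg norm (rotSum_mul_phase_sub_one θ n)
  rw [norm_mul] at h
  have h2 := norm_phase_sub_one_le θ
  have h4 : (0 : ℝ) ≤ n * θ := by positivity
  have h3 := le_norm_phase_sub_one (t := n * θ) (by rwa [abs_of_nonneg h4])
  rw [abs_of_nonneg h4] at h3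
  rw [abs_of_pos h0] at h2
  rw [div_le_iff₀ Real.pi_pos]
  have h5 : 4 * (n * θ) ≤ ‖rotSum θ n‖ * (2 * Real.pi * θ) := by
    rw [← h] at h3
    exact h3.trans (mul_le_mul_of_nonneg_left h2 (norm_nonneg _))
  nlinarith

/-! ### Trigonometric series -/

/-- The trigonometric series `∑ j, Re (a j * exp (2 π i (q j) x))`. -/
noncomputable def trigSum (a : ℕ → ℂ) (q : ℕ → ℕ) (x : ℝ) : ℝ :=
  ∑' j, (a j * phase (q j * x)).re

theorem abs_re_mul_phase_le (a : ℂ) (t : ℝ) : |(a * phase t).re| ≤ ‖a‖ := by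
  refine (Complex.abs_re_le_norm _).trans ?_
  rw [norm_mul, norm_phase, mul_one]

section trigSum
variable {a : ℕ → ℂ} {q : ℕ → ℕ}

theorem summable_trigSum (ha : Summable fun j => ‖a j‖) (x : ℝ) :
    Summable fun j => (a j * phase (q j * x)).re :=
  Summable.of_norm_bounded ha fun _ => abs_re_mul_phase_le _ _

theorem trigSum_periodic (a : ℕ → ℂ) {q : ℕ → ℕ} {m : ℝ} (hm : ∀ j, ∃ k : ℤ, q j * m = k) :
    Function.Periodic (trigSum a q) m := by
  intro x
  refine tsum_congr fun j => ?_
  obtain ⟨k, hk⟩ := hm j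
  rw [mul_add, hk, phase_add_intCast]

theorem trigSum_periodic_one (a : ℕ → ℂ) (q : ℕ → ℕ) : Function.Periodic (trigSum a q) 1 :=
  trigSum_periodic a fun j => ⟨q j, by simp⟩

theorem hasDerivAt_trigSum (ha : Summable fun j => ‖a j‖)
    (ha' : Summable fun j => (q j : ℝ) * ‖a j‖) (x : ℝ) :
    HasDerivAt (trigSum a q)
      (trigSum (fun j => Complex.I * ((2 * Real.pi * q j : ℝ) : ℂ) * a j) q x) x := by
  refine hasDerivAt_tsum (𝕜 := ℝ) (F := ℝ) (g := fun j x => (a j * phase (q j * x)).re)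
    (g' := fun j x => (Complex.I * ((2 * Real.pi * q j : ℝ) : ℂ) * a j * phase (q j * x)).re)
    (u := fun j => 2 * Real.pi * ((q j : ℝ) * ‖a j‖)) (ha'.mul_left _)
    (y₀ := 0) (fun j y => ?_) (fun j y => ?_) (summable_trigSum ha 0) x
  · have h1 : HasDerivAt (fun y : ℝ => (q j : ℝ) * y) (q j) y := by
      simpa using (hasDerivAt_id y).const_mul (q j : ℝ)
    have h2 := (hasDerivAt_phase_comp h1).const_mul (a j)
    have h3 : HasDerivAt (fun y : ℝ => (a j * phase (q j * y)).re)
        (a j * (phase (q j * y) * (Complex.I * ((2 * Real.pi * q j : ℝ) : ℂ)))).re y :=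
      Complex.reCLM.hasFDerivAt.comp_hasDerivAt y h2
    refine h3.congr_deriv (congrArg Complex.re ?_)
    ring
  · refine (abs_re_mul_phase_le _ _).trans (le_of_eq ?_)
    rw [norm_mul, norm_mul, Complex.norm_I, Complex.norm_real, Real.norm_eq_abs,
      abs_of_nonneg (by positivity)]
    ring

theorem abs_trigSum_le (ha : Summable fun j => ‖a j‖) (x : ℝ) :
    |trigSum a q x| ≤ ∑' j, ‖a j‖ :=
  tsum_of_norm_bounded (E := ℝ) ha.hasSum fun _ => abs_re_mul_phase_le _ _

theorem abs_trigSum_sub_le (ha : Summable fun j => ‖a j‖) (k : ℕ) (x : ℝ) :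
    |trigSum a q x - (a k * phase (q k * x)).re| ≤ ∑' j, if j = k then 0 else ‖a j‖ := by
  rw [trigSum, (summable_trigSum ha x).tsum_eq_add_tsum_ite k, add_sub_cancel_left]
  refine tsum_of_norm_bounded (E := ℝ) (Summable.hasSum ?_) fun j => ?_
  · refine Summable.of_nonneg_of_le (fun j => ?_) (fun j => ?_) ha
    · split_ifs <;> simp
    · split_ifs <;> simp
  · split_ifs
    · simp
    · exact abs_re_mul_phase_le _ _

theorem continuous_trigSum (ha : Summable fun j => ‖a j‖) : Continuous (trigSum a q) := by
  refine continuous_tsum (fun j => ?_) ha fun j x => abs_re_mul_phase_le _ _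
  exact Complex.continuous_re.comp (continuous_const.mul (continuous_phase.comp (by fun_prop)))

theorem sum_trigSum_rotation (ha : Summable fun j => ‖a j‖) (α x : ℝ) (n : ℕ) :
    ∑ i ∈ Finset.range n, trigSum a q (x + i * α) =
      trigSum (fun j => a j * rotSum (q j * α) n) q x := by
  simp only [trigSum]
  rw [← Summable.tsum_finsetSum fun i _ => summable_trigSum ha _]
  refine tsum_congr fun j => ?_
  rw [← Complex.re_sum, rotSum, Finset.mul_sum, Finset.sum_mul]
  congr 1
  refine Finset.sum_congr rfl fun i _ => ?_
  rw [mul_add, phase_add, mul_assoc, mul_comm (phase (q j * x)),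
    show (q j : ℝ) * (i * α) = i * (q j * α) by ring]

theorem abs_trigSum_sub_trigSum_le (ha : Summable fun j => ‖a j‖)
    (ha' : Summable fun j => (q j : ℝ) * ‖a j‖) (x y : ℝ) :
    |trigSum a q x - trigSum a q y| ≤ 2 * Real.pi * (∑' j, (q j : ℝ) * ‖a j‖) * |x - y| := by
  have e : ∀ j, ‖Complex.I * ((2 * Real.pi * q j : ℝ) : ℂ) * a j‖ =
      2 * Real.pi * ((q j : ℝ) * ‖a j‖) := fun j => by
    rw [norm_mul, norm_mul, Complex.norm_I, Complex.norm_real, Real.norm_eq_abs,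
      abs_of_nonneg (by positivity)]
    ring
  have := Convex.norm_image_sub_le_of_norm_hasDerivWithin_le (s := univ) (x := y) (y := x)
    (C := 2 * Real.pi * (∑' j, (q j : ℝ) * ‖a j‖))
    (fun z _ => (hasDerivAt_trigSum ha ha' z).hasDerivWithinAt) (fun z _ => ?_)
    convex_univ (mem_univ _) (mem_univ _)
  · exact this
  · refine (abs_trigSum_le ?_ z).trans (le_of_eq ?_)
    · simp only [e]; exact ha'.mul_left _
    · simp only [e]; exact tsum_mul_left

/-- The exponential weights dominate the complexified terms on the strip |Im z| < 1, so the series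
is the restriction of a holomorphic function. -/
theorem analyticOnNhd_trigSum
    (ha : Summable fun j => ‖a j‖ * Real.exp (2 * Real.pi * q j)) :
    AnalyticOnNhd ℝ (trigSum a q) univ := by
  set G : ℂ → ℂ := fun z => ∑' j, a j * Complex.exp (Complex.I * ((2 * Real.pi * q j : ℝ) : ℂ) * z)
  have hopen : IsOpen {z : ℂ | |z.im| < 1} :=
    isOpen_lt (continuous_abs.comp Complex.continuous_im) continuous_const
  have hG : DifferentiableOn ℂ G {z : ℂ | |z.im| < 1} := by
    refine Complex.differentiableOn_tsum_of_summable_norm ha (fun j => ?_) hopen fun j z hz => ?_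
    · exact Differentiable.differentiableOn (by fun_prop)
    · rw [norm_mul, Complex.norm_exp]
      refine mul_le_mul_of_nonneg_left (Real.exp_le_exp.2 ?_) (norm_nonneg _)
      have : (Complex.I * ((2 * Real.pi * q j : ℝ) : ℂ) * z).re = 2 * Real.pi * q j * (- z.im) := by
        simp [mul_assoc]
      rw [this]
      have h1 : -z.im ≤ 1 := (neg_le_abs _).trans (le_of_lt hz)
      exact mul_le_of_le_one_right (by positivity) h1
  have ha0 : Summable fun j => ‖a j‖ := by
    refine Summable.of_nonneg_of_le (fun _ => norm_nonneg _) (fun j => ?_) ha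
    exact le_mul_of_one_le_right (norm_nonneg _) (Real.one_le_exp (by positivity))
  intro x _
  have h1 : AnalyticAt ℂ G (x : ℂ) := hG.analyticOnNhd hopen x (by simp)
  have h2 : AnalyticAt ℝ (fun y : ℝ => (G y).re) x :=
    (Complex.reCLM.analyticAt _).comp
      ((h1.restrictScalars (𝕜 := ℝ)).comp (Complex.ofRealCLM.analyticAt x))
  refine h2.congr (Eventually.of_forall fun y => ?_)
  have hs : Summable fun j => a j * phase (q j * y) := by
    refine Summable.of_norm_bounded ha0 fun j => ?_
    rw [norm_mul, norm_phase, mul_one]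
  have e : G y = ∑' j, a j * phase (q j * y) := by
    refine tsum_congr fun j => ?_
    rw [phase]; congr 2; push_cast; ring
  change (G y).re = _
  rw [e, Complex.re_tsum hs, trigSum]

end trigSum

/-! ### Oscillatory integrals -/

theorem integral_inv_one_add_sq_le {ε : ℝ} (hε : 0 < ε) (a b c : ℝ) :
    ∫ x in a..b, (1 + (4 / ε * x + c) ^ 2)⁻¹ ≤ Real.pi / 4 * ε := by
  rw [intervalIntegral.integral_comp_mul_add (fun y => (1 + y ^ 2)⁻¹) (by positivity) c,
    integral_inv_one_add_sq, smul_eq_mul, inv_div]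
  have h1 := (Real.arctan_lt_pi_div_two (4 / ε * b + c)).le
  have h2 := (Real.neg_pi_div_two_lt_arctan (4 / ε * a + c)).le
  nlinarith

/-- On each half period |cos 2πx| ≥ 4|x - c|, with c = 1/4 or 3/4 the zero. The integrand thus lies
below a Cauchy kernel of integral at most πε/4. -/
theorem integral_cos_kernel_le {ε : ℝ} (hε : 0 < ε) :
    ∫ x in (0 : ℝ)..1, ε ^ 2 / (Real.cos (2 * Real.pi * x) ^ 2 + ε ^ 2) ≤ 2 * ε := by
  have hpos : ∀ x : ℝ, Real.cos (2 * Real.pi * x) ^ 2 + ε ^ 2 ≠ 0 := fun x => by positivity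
  have hpos2 : ∀ x : ℝ, 1 + x ^ 2 ≠ 0 := fun x => by positivity
  have hc : Continuous fun x : ℝ => ε ^ 2 / (Real.cos (2 * Real.pi * x) ^ 2 + ε ^ 2) :=
    Continuous.div (by fun_prop) (by fun_prop) hpos
  have hi : ∀ a b, IntervalIntegrable
      (fun x : ℝ => ε ^ 2 / (Real.cos (2 * Real.pi * x) ^ 2 + ε ^ 2)) volume a b :=
    fun a b => hc.intervalIntegrable a b
  have hi2 : ∀ c a b, IntervalIntegrable
      (fun x : ℝ => (1 + (4 / ε * x + c) ^ 2)⁻¹) volume a b := fun c a b =>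
    (Continuous.inv₀ (by fun_prop) fun x => hpos2 _).intervalIntegrable a b
  have key : ∀ x c : ℝ, |x - c| ≤ 1 / 4 →
      |Real.cos (2 * Real.pi * x)| = |Real.sin (2 * Real.pi * (x - c))| →
      ε ^ 2 / (Real.cos (2 * Real.pi * x) ^ 2 + ε ^ 2) ≤
        (1 + (4 / ε * x + -(4 / ε * c)) ^ 2)⁻¹ := by
    intro x c hx he
    have h1 : 4 * |x - c| ≤ |Real.cos (2 * Real.pi * x)| := by
      have hb : |2 * Real.pi * (x - c)| ≤ Real.pi / 2 := by
        rw [abs_mul, abs_of_pos Real.two_pi_pos]; nlinarith [Real.pi_pos]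
      have h := Real.mul_abs_le_abs_sin hb
      rw [abs_mul, abs_of_pos Real.two_pi_pos] at h
      have e : 2 / Real.pi * (2 * Real.pi * |x - c|) = 4 * |x - c| := by field_simp; ring
      rw [he, ← e]; exact h
    have h2 : (4 * |x - c|) ^ 2 ≤ Real.cos (2 * Real.pi * x) ^ 2 := by
      rw [← sq_abs (Real.cos _)]; gcongr
    rw [mul_pow, sq_abs] at h2
    have e : (1 + (4 / ε * x + -(4 / ε * c)) ^ 2)⁻¹ = ε ^ 2 / (4 ^ 2 * (x - c) ^ 2 + ε ^ 2) := by
      field_simp; ring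
    rw [e]
    gcongr
  rw [← intervalIntegral.integral_add_adjacent_intervals (hi 0 (1 / 2)) (hi (1 / 2) 1)]
  have b1 := (intervalIntegral.integral_mono_on (by norm_num) (hi 0 (1 / 2))
    (hi2 (-(4 / ε * (1 / 4))) 0 (1 / 2)) fun x hx => key x (1 / 4)
      (by rw [abs_le]; constructor <;> linarith [hx.1, hx.2]) (by
      rw [show 2 * Real.pi * (x - 1 / 4) = 2 * Real.pi * x - Real.pi / 2 by ring,
        Real.sin_sub_pi_div_two, abs_neg])).trans (integral_inv_one_add_sq_le hε _ _ _)
  have b2 := (intervalIntegral.integral_mono_on (by norm_num) (hi (1 / 2) 1)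
    (hi2 (-(4 / ε * (3 / 4))) (1 / 2) 1) fun x hx => key x (3 / 4)
      (by rw [abs_le]; constructor <;> linarith [hx.1, hx.2]) (by
      rw [show 2 * Real.pi * (x - 3 / 4) = 2 * Real.pi * x + Real.pi / 2 - 2 * Real.pi by ring,
        Real.sin_sub_two_pi, Real.sin_add_pi_div_two])).trans (integral_inv_one_add_sq_le hε _ _ _)
  nlinarith [Real.pi_lt_four]

theorem integral_comp_nat_mul_add {f : ℝ → ℝ} (hf : Continuous f) (hp : Function.Periodic f 1)
    {q : ℕ} (hq : 1 ≤ q) (s : ℝ) : ∫ x in (0 : ℝ)..1, f (q * x + s) = ∫ x in (0 : ℝ)..1, f x := by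
  have hq0 : (q : ℝ) ≠ 0 := by positivity
  rw [intervalIntegral.integral_comp_mul_add f hq0 s]
  have h := hp.intervalIntegral_add_zsmul_eq q s fun a b => hf.intervalIntegrable a b
  have h2 := hp.intervalIntegral_add_eq s 0
  rw [zero_add] at h2
  rw [h2] at h
  have e : (q : ℝ) * 1 + s = s + ((q : ℤ) • (1 : ℝ)) := by simp [add_comm]
  rw [mul_zero, zero_add, e, h]
  simp [hq0]

/-- Integration by parts that tolerates critical points of F: write 1 = F'²/(F'² + M²) + M²/(F'² +
M²). The first part is integrated by parts against v = F'/(F'² + M²), where |v'| ≤ K/M² and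
periodicity cancels the boundary terms. The second part measures where |F'| is not much larger than
M. -/
theorem norm_integral_phase_le {F F' F'' : ℝ → ℝ} (hF : ∀ x, HasDerivAt F (F' x) x)
    (hF' : ∀ x, HasDerivAt F' (F'' x) x) (hc : Continuous F'') (hp : Function.Periodic F 1)
    (hp' : Function.Periodic F' 1) {K M : ℝ} (hM : 0 < M) (hK : ∀ x, |F'' x| ≤ K) :
    ‖∫ x in (0 : ℝ)..1, phase (F x)‖ ≤
      K / (2 * Real.pi * M ^ 2) + ∫ x in (0 : ℝ)..1, M ^ 2 / (F' x ^ 2 + M ^ 2) := by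
  have hFc : Continuous F := continuous_iff_continuousAt.2 fun x => (hF x).continuousAt
  have hF'c : Continuous F' := continuous_iff_continuousAt.2 fun x => (hF' x).continuousAt
  have hpos : ∀ x, 0 < F' x ^ 2 + M ^ 2 := fun x => by positivity
  set v : ℝ → ℝ := fun x => F' x / (F' x ^ 2 + M ^ 2)
  set v' : ℝ → ℝ := fun x => F'' x * (M ^ 2 - F' x ^ 2) / (F' x ^ 2 + M ^ 2) ^ 2
  have hv : ∀ x, HasDerivAt v (v' x) x := fun x => by
    refine ((hF' x).div (((hF' x).pow 2).add_const (M ^ 2)) (hpos x).ne').congr_deriv ?_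
    simp only [v']
    congr 1
    simp only [Pi.pow_apply]
    push_cast
    ring
  have hv'c : Continuous v' :=
    Continuous.div (by fun_prop) (by fun_prop) fun x => (pow_pos (hpos x) 2).ne'
  have hvc : Continuous v := Continuous.div (by fun_prop) (by fun_prop) fun x => (hpos x).ne'
  have hv'b : ∀ x, |v' x| ≤ K / M ^ 2 := fun x => by
    simp only [v']
    rw [abs_div, abs_mul, abs_of_pos (pow_pos (hpos x) 2)]
    have h1 : |M ^ 2 - F' x ^ 2| ≤ F' x ^ 2 + M ^ 2 := by
      rw [abs_le]; constructor <;> nlinarith [sq_nonneg (F' x), sq_nonneg M]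
    have hK0 : 0 ≤ K := (abs_nonneg _).trans (hK x)
    rw [div_le_div_iff₀ (pow_pos (hpos x) 2) (by positivity)]
    have h2 : M ^ 2 ≤ F' x ^ 2 + M ^ 2 := by nlinarith [sq_nonneg (F' x)]
    calc |F'' x| * |M ^ 2 - F' x ^ 2| * M ^ 2
        ≤ K * (F' x ^ 2 + M ^ 2) * (F' x ^ 2 + M ^ 2) := by
          gcongr
          exact hK x
      _ = K * (F' x ^ 2 + M ^ 2) ^ 2 := by ring
  have hPc : Continuous fun x => phase (F x) := continuous_phase.comp hFc
  have hparts := intervalIntegral.integral_mul_deriv_eq_deriv_mul (a := 0) (b := 1)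
    (u := fun x => (v x : ℂ)) (u' := fun x => (v' x : ℂ)) (v := fun x => phase (F x))
    (v' := fun x => phase (F x) * (Complex.I * ((2 * Real.pi * F' x : ℝ) : ℂ)))
    (fun x _ => (hv x).ofReal_comp) (fun x _ => hasDerivAt_phase_comp (hF x))
    ((Complex.continuous_ofReal.comp hv'c).intervalIntegrable _ _)
    (Continuous.intervalIntegrable (by fun_prop) _ _)
  have e1 : phase (F 1) = phase (F 0) := by rw [← hp 0, zero_add]
  have e2 : v 1 = v 0 := by simp only [v]; rw [← hp' 0, zero_add]
  simp only [e1, e2, sub_self, zero_sub] at hparts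
  have split : ∀ x, phase (F x) = (2 * Real.pi * Complex.I)⁻¹ *
      ((v x : ℂ) * (phase (F x) * (Complex.I * ((2 * Real.pi * F' x : ℝ) : ℂ)))) +
      phase (F x) * ((M ^ 2 / (F' x ^ 2 + M ^ 2) : ℝ) : ℂ) := fun x => by
    have h1 : ((F' x : ℂ) ^ 2 + (M : ℂ) ^ 2) ≠ 0 := by exact_mod_cast (hpos x).ne'
    have hpi : (Real.pi : ℂ) ≠ 0 := by exact_mod_cast Real.pi_ne_zero
    have hI := Complex.I_ne_zero
    simp only [v]
    push_cast
    field_simp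
  have hc3 : Continuous fun x => M ^ 2 / (F' x ^ 2 + M ^ 2) :=
    Continuous.div (by fun_prop) (by fun_prop) fun x => (hpos x).ne'
  rw [intervalIntegral.integral_congr fun x _ => split x, intervalIntegral.integral_add
    (Continuous.intervalIntegrable (by fun_prop) _ _)
    (Continuous.intervalIntegrable (by fun_prop) _ _), intervalIntegral.integral_const_mul, hparts]
  refine (norm_add_le _ _).trans (add_le_add ?_ ?_)
  · have h1 : ‖∫ x in (0 : ℝ)..1, (v' x : ℂ) * phase (F x)‖ ≤ K / M ^ 2 := by
      have := intervalIntegral.norm_integral_le_of_norm_le_const (a := 0) (b := 1)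
        (f := fun x => (v' x : ℂ) * phase (F x)) (C := K / M ^ 2) fun x _ => by
          rw [norm_mul, norm_phase, mul_one, Complex.norm_real]; exact hv'b x
      simpa using this
    rw [norm_mul, norm_neg, norm_inv, norm_mul, Complex.norm_I, mul_one, norm_mul,
      Complex.norm_real, Real.norm_eq_abs, abs_of_pos Real.pi_pos, Complex.norm_two]
    calc (2 * Real.pi)⁻¹ * _ ≤ (2 * Real.pi)⁻¹ * (K / M ^ 2) := by gcongr
      _ = _ := by field_simp
  · have h2 := intervalIntegral.norm_integral_le_integral_norm (μ := volume) (a := 0) (b := 1)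
      (f := fun x => phase (F x) * ((M ^ 2 / (F' x ^ 2 + M ^ 2) : ℝ) : ℂ)) zero_le_one
    refine h2.trans (le_of_eq (intervalIntegral.integral_congr fun x _ => ?_))
    rw [norm_mul, norm_phase, one_mul, Complex.norm_real, Real.norm_eq_abs,
      abs_of_nonneg (div_nonneg (sq_nonneg _) (hpos x).le)]

theorem re_mul_phase_eq (w : ℂ) : ∃ s : ℝ, ∀ t, (w * phase t).re =
    ‖w‖ * Real.cos (2 * Real.pi * (t + s)) := by
  refine ⟨w.arg / (2 * Real.pi), fun t => ?_⟩
  have h : w = ‖w‖ * phase (w.arg / (2 * Real.pi)) := by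
    conv_lhs => rw [← Complex.norm_mul_exp_arg_mul_I w]
    rw [phase, mul_div_cancel₀ _ Real.two_pi_pos.ne', mul_comm Complex.I]
  conv_lhs => rw [h]
  rw [mul_assoc, ← phase_add, Complex.re_ofReal_mul, phase_re, add_comm t]

/-! ### Series with one dominating frequency -/

section
variable {a : ℕ → ℂ} {q : ℕ → ℕ}

theorem tsum_ite_le_of_le {f g : ℕ → ℝ} (hf : ∀ j, 0 ≤ f j) (hfg : ∀ j, f j ≤ g j)
    (hg : Summable g) (k : ℕ) :
    ∑' j, (if j = k then 0 else f j) ≤ ∑' j, (if j = k then 0 else g j) := by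
  have h0 : ∀ j, 0 ≤ g j := fun j => (hf j).trans (hfg j)
  have hs : Summable fun j => if j = k then 0 else g j :=
    Summable.of_nonneg_of_le (fun j => by split_ifs <;> simp [h0])
      (fun j => by split_ifs <;> simp [h0]) hg
  refine Summable.tsum_le_tsum (fun j => by split_ifs <;> simp [hfg]) ?_ hs
  exact Summable.of_nonneg_of_le (fun j => by split_ifs <;> simp [hf])
      (fun j => by split_ifs <;> simp [hfg]) hs

/-- A trigonometric series with one dominating term gives a small oscillatory integral. -/
theorem norm_integral_phase_trigSum_le (hq : ∀ j, 1 ≤ q j)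
    (ha : Summable fun j => (q j : ℝ) ^ 2 * ‖a j‖) {k : ℕ} {s : ℝ} (hs : 1 ≤ s)
    (hk : s ^ 3 ≤ ‖a k‖)
    (hE : ∑' j, (if j = k then 0 else (q j : ℝ) ^ 2 * ‖a j‖) ≤ s ^ 2 / 2) :
    ‖∫ x in (0 : ℝ)..1, phase (trigSum a q x)‖ ≤ 5 / s := by
  have hpi := Real.pi_pos
  have hq1 : ∀ j, (1 : ℝ) ≤ q j := fun j => by exact_mod_cast hq j
  have le1 : ∀ j, (q j : ℝ) * ‖a j‖ ≤ (q j : ℝ) ^ 2 * ‖a j‖ := fun j =>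
    mul_le_mul_of_nonneg_right (by nlinarith [hq1 j]) (norm_nonneg _)
  have le0 : ∀ j, ‖a j‖ ≤ (q j : ℝ) * ‖a j‖ := fun j =>
    le_mul_of_one_le_left (norm_nonneg _) (hq1 j)
  have s1 : Summable fun j => (q j : ℝ) * ‖a j‖ :=
    Summable.of_nonneg_of_le (fun j => by positivity) le1 ha
  have s0 : Summable fun j => ‖a j‖ :=
    Summable.of_nonneg_of_le (fun j => by positivity) le0 s1
  set E := ∑' j, (if j = k then 0 else (q j : ℝ) ^ 2 * ‖a j‖)
  set B := ‖a k‖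
  set a1 : ℕ → ℂ := fun j => Complex.I * ((2 * Real.pi * q j : ℝ) : ℂ) * a j
  set a2 : ℕ → ℂ := fun j => Complex.I * ((2 * Real.pi * q j : ℝ) : ℂ) * a1 j
  have n1 : ∀ j, ‖a1 j‖ = 2 * Real.pi * ((q j : ℝ) * ‖a j‖) := fun j => by
    simp only [a1]
    rw [norm_mul, norm_mul, Complex.norm_I, Complex.norm_real, Real.norm_eq_abs,
      abs_of_nonneg (by positivity)]
    ring
  have n2 : ∀ j, ‖a2 j‖ = (2 * Real.pi) ^ 2 * ((q j : ℝ) ^ 2 * ‖a j‖) := fun j => by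
    simp only [a2]
    rw [norm_mul, norm_mul, Complex.norm_I, Complex.norm_real, Real.norm_eq_abs,
      abs_of_nonneg (by positivity), n1]
    ring
  have t1 : Summable fun j => ‖a1 j‖ := by simp only [n1]; exact s1.mul_left _
  have t1' : Summable fun j => (q j : ℝ) * ‖a1 j‖ := by
    simp only [n1]
    exact (ha.mul_left (2 * Real.pi)).congr fun j => by ring
  have t2 : Summable fun j => ‖a2 j‖ := by simp only [n2]; exact ha.mul_left _
  have d1 : ∀ x, |trigSum a1 q x - (a1 k * phase (q k * x)).re| ≤ 2 * Real.pi * E := fun x => by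
    refine (abs_trigSum_sub_le t1 k x).trans ?_
    have := tsum_ite_le_of_le (fun j => norm_nonneg (a1 j))
      (g := fun j => 2 * Real.pi * ((q j : ℝ) ^ 2 * ‖a j‖)) (fun j => by
        rw [n1]; exact mul_le_mul_of_nonneg_left (le1 j) (by positivity)) (ha.mul_left _) k
    refine this.trans (le_of_eq ?_)
    rw [← tsum_mul_left]
    exact tsum_congr fun j => by split_ifs <;> simp
  have d2 : ∀ x, |trigSum a2 q x| ≤ (2 * Real.pi) ^ 2 * ((q k : ℝ) ^ 2 * B + E) := fun x => by
    refine (abs_trigSum_le t2 x).trans (le_of_eq ?_)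
    simp only [n2]
    rw [tsum_mul_left, ha.tsum_eq_add_tsum_ite k]
  -- The amplitude of the derivative of the dominating term, divided by s. Then the error K/M² is of
  -- order s²/B ≤ 1/s because s³ ≤ B, and the remaining integral is a cosine kernel of width 1/s.
  set M : ℝ := 2 * Real.pi * q k * B / s
  have hs0 : 0 < s := by linarith
  have hB : 0 < B := lt_of_lt_of_le (by positivity) hk
  have hqk := hq1 k
  have hM : 0 < M := by positivity
  obtain ⟨r, hr⟩ := re_mul_phase_eq (a1 k)
  have main := norm_integral_phase_le (fun x => hasDerivAt_trigSum s0 s1 x)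
    (fun x => hasDerivAt_trigSum t1 t1' x) (continuous_trigSum t2)
    (trigSum_periodic_one a q) (trigSum_periodic_one a1 q) hM d2
  refine main.trans ?_
  have hEB : E ≤ B / s / 2 := by
    refine hE.trans ?_
    have : s ^ 2 ≤ B / s := by rw [le_div_iff₀ hs0]; nlinarith
    linarith
  have p1 : (2 * Real.pi) ^ 2 * ((q k : ℝ) ^ 2 * B + E) / (2 * Real.pi * M ^ 2) ≤ 1 / s := by
    have hE2 : E ≤ (q k : ℝ) ^ 2 * B := by
      have : B / s ≤ B := div_le_self hB.le hs
      nlinarith [mul_le_mul_of_nonneg_right hqk hB.le]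
    have e : 2 * Real.pi * M ^ 2 = (2 * Real.pi) ^ 3 * (q k : ℝ) ^ 2 * B ^ 2 / s ^ 2 := by
      simp only [M]; field_simp
    rw [e, div_div_eq_mul_div, div_le_div_iff₀ (by positivity) hs0]
    calc (2 * Real.pi) ^ 2 * ((q k : ℝ) ^ 2 * B + E) * s ^ 2 * s
        = (2 * Real.pi) ^ 2 * ((q k : ℝ) ^ 2 * B + E) * s ^ 3 := by ring
      _ ≤ (2 * Real.pi) ^ 2 * ((q k : ℝ) ^ 2 * B + (q k : ℝ) ^ 2 * B) * B := by gcongr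
      _ = (2 * Real.pi) ^ 2 * (q k : ℝ) ^ 2 * B ^ 2 * 2 := by ring
      _ ≤ (2 * Real.pi) ^ 2 * (q k : ℝ) ^ 2 * B ^ 2 * (2 * Real.pi) := by
          gcongr; nlinarith [Real.pi_gt_three]
      _ = 1 * ((2 * Real.pi) ^ 3 * (q k : ℝ) ^ 2 * B ^ 2) := by ring
  have hkern : Continuous fun x : ℝ =>
      (1 / s) ^ 2 / (Real.cos (2 * Real.pi * x) ^ 2 + (1 / s) ^ 2) :=
    Continuous.div (by fun_prop) (by fun_prop) fun x => by positivity
  have p2 : ∫ x in (0 : ℝ)..1, M ^ 2 / (trigSum a1 q x ^ 2 + M ^ 2) ≤ 4 / s := by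
    have hb : ∀ x, M ^ 2 / (trigSum a1 q x ^ 2 + M ^ 2) ≤
        2 * ((1 / s) ^ 2 / (Real.cos (2 * Real.pi * (q k * x + r)) ^ 2 + (1 / s) ^ 2)) := fun x => by
      have h1 := d1 x
      rw [hr, n1] at h1
      set c := Real.cos (2 * Real.pi * (q k * x + r))
      have hD : 2 * Real.pi * E ≤ M / 2 := by
        have : M / 2 = 2 * Real.pi * (q k * (B / s / 2)) := by simp only [M]; ring
        rw [this]
        refine mul_le_mul_of_nonneg_left (hEB.trans ?_) (by positivity)
        exact le_mul_of_one_le_left (by positivity) hqk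
      have hW : 2 * Real.pi * (q k * ‖a k‖) = M * s := by simp only [M]; field_simp; rfl
      rw [hW] at h1
      have h2 := h1.trans hD
      have h3 : (M * s * c) ^ 2 / 2 + M ^ 2 / 2 ≤ trigSum a1 q x ^ 2 + M ^ 2 := by
        have h4 : (trigSum a1 q x - M * s * c) ^ 2 ≤ (M / 2) ^ 2 := by
          rw [← sq_abs]; gcongr
        -- With T the derivative and w its dominating part, T² - w²/2 + (T - w)² = (2T - w)²/2 ≥ 0.
        nlinarith [sq_nonneg (2 * trigSum a1 q x - M * s * c)]
      have e : 2 * ((1 / s) ^ 2 / (c ^ 2 + (1 / s) ^ 2)) =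
          M ^ 2 / ((M * s * c) ^ 2 / 2 + M ^ 2 / 2) := by
        field_simp
      rw [e]
      gcongr
    have hper : Function.Periodic (fun x : ℝ =>
        (1 / s) ^ 2 / (Real.cos (2 * Real.pi * x) ^ 2 + (1 / s) ^ 2)) 1 := fun x => by
      simp only [mul_add, mul_one, Real.cos_add_two_pi]
    have hI := integral_comp_nat_mul_add hkern hper (hq k) r
    have hct : Continuous (trigSum a1 q) := continuous_trigSum t1
    have hcl : Continuous fun x => M ^ 2 / (trigSum a1 q x ^ 2 + M ^ 2) :=
      Continuous.div (by fun_prop) (by fun_prop) fun x => by positivity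
    have hcr : Continuous fun x : ℝ =>
        2 * ((1 / s) ^ 2 / (Real.cos (2 * Real.pi * (q k * x + r)) ^ 2 + (1 / s) ^ 2)) :=
      continuous_const.mul (hkern.comp (by fun_prop : Continuous fun x : ℝ => (q k : ℝ) * x + r))
    refine (intervalIntegral.integral_mono_on zero_le_one (hcl.intervalIntegrable _ _)
      (hcr.intervalIntegrable _ _) fun x _ => hb x).trans ?_
    rw [intervalIntegral.integral_const_mul, hI]
    have := integral_cos_kernel_le (ε := 1 / s) (by positivity)
    calc _ ≤ 2 * (2 * (1 / s)) := by gcongr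
      _ = _ := by ring
  calc _ ≤ 1 / s + 4 / s := add_le_add p1 p2
    _ = 5 / s := by ring

/-- The derivative of a trigonometric series attains the size of each of its terms, up to the other
terms. -/
theorem exists_abs_trigSum_deriv_ge (ha : Summable fun j => (q j : ℝ) * ‖a j‖) {k : ℕ}
    (hq : 1 ≤ q k) :
    ∃ x, 2 * Real.pi * (q k * ‖a k‖ - ∑' j, (if j = k then 0 else (q j : ℝ) * ‖a j‖)) ≤
      |trigSum (fun j => Complex.I * ((2 * Real.pi * q j : ℝ) : ℂ) * a j) q x| := by
  set a1 : ℕ → ℂ := fun j => Complex.I * ((2 * Real.pi * q j : ℝ) : ℂ) * a j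
  have n1 : ∀ j, ‖a1 j‖ = 2 * Real.pi * ((q j : ℝ) * ‖a j‖) := fun j => by
    simp only [a1]
    rw [norm_mul, norm_mul, Complex.norm_I, Complex.norm_real, Real.norm_eq_abs,
      abs_of_nonneg (mul_nonneg Real.two_pi_pos.le (Nat.cast_nonneg _))]
    ring
  have t1 : Summable fun j => ‖a1 j‖ := by simp only [n1]; exact ha.mul_left _
  obtain ⟨r, hr⟩ := re_mul_phase_eq (a1 k)
  have hq0 : (q k : ℝ) ≠ 0 := by positivity
  -- The point where the k-th term of the derivative takes its maximal value.
  refine ⟨-r / q k, ?_⟩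
  have h := abs_trigSum_sub_le (q := q) t1 k (-r / q k)
  rw [hr, mul_div_cancel₀ _ hq0, neg_add_cancel, mul_zero, Real.cos_zero, mul_one, n1] at h
  have e : ∑' j, (if j = k then 0 else ‖a1 j‖) =
      2 * Real.pi * ∑' j, (if j = k then 0 else (q j : ℝ) * ‖a j‖) := by
    rw [← tsum_mul_left]
    exact tsum_congr fun j => by split_ifs <;> simp [n1]
  rw [e] at h
  have := abs_le.1 h
  have h3 := le_abs_self (trigSum a1 q (-r / q k))
  linarith [this.1]

end

/-! ### Functions on the circle -/

/-- The representative of `t` is replaced by its integer translate nearest to that of `s`. -/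
theorem abs_lift_sub_lift_le {F : ℝ → ℝ} (hF : Function.Periodic F 1) {K : ℝ}
    (hK : ∀ x y, |F x - F y| ≤ K * |x - y|) (s t : UnitAddCircle) :
    |hF.lift s - hF.lift t| ≤ K * ‖s - t‖ := by
  induction s using QuotientAddGroup.induction_on with | _ x => ?_
  induction t using QuotientAddGroup.induction_on with | _ y => ?_
  have h1 : ‖((x : UnitAddCircle) - (y : UnitAddCircle))‖ = |x - (y + round (x - y))| := by
    rw [← AddCircle.coe_sub, UnitAddCircle.norm_eq, sub_sub]
  have h2 : F y = F (y + round (x - y)) := by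
    have := hF.int_mul (round (x - y)) y
    rw [mul_one] at this
    exact this.symm
  change |F x - F y| ≤ K * ‖((x : UnitAddCircle) - (y : UnitAddCircle))‖
  rw [h1, h2]
  exact hK _ _

theorem continuous_lift {F : ℝ → ℝ} (hF : Function.Periodic F 1) (hc : Continuous F) :
    Continuous (hF.lift : UnitAddCircle → ℝ) :=
  continuous_coinduced_dom.2 hc

theorem norm_coe_unitAddCircle_le (r : ℝ) : ‖(r : UnitAddCircle)‖ ≤ |r| := by
  rw [UnitAddCircle.norm_eq]
  simpa using round_le r 0

/-- The standard character of the circle. -/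
noncomputable def circleExp (x : UnitAddCircle) : ℂ := fourier 1 x

theorem circleExp_coe (t : ℝ) : circleExp (t : UnitAddCircle) = phase t := by
  rw [circleExp, fourier_coe_apply, phase]; congr 1; push_cast; ring

theorem circleExp_add (x y : UnitAddCircle) : circleExp (x + y) = circleExp x * circleExp y := by
  induction x using QuotientAddGroup.induction_on with | _ x => ?_
  induction y using QuotientAddGroup.induction_on with | _ y => ?_
  have := circleExp_coe (x + y)
  rw [phase_add, ← circleExp_coe, ← circleExp_coe, AddCircle.coe_add] at this
  exact this

theorem norm_circleExp (x : UnitAddCircle) : ‖circleExp x‖ = 1 := by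
  induction x using QuotientAddGroup.induction_on with | _ x => ?_
  exact (congrArg norm (circleExp_coe x)).trans (norm_phase x)

theorem continuous_circleExp : Continuous circleExp := (fourier 1).continuous

theorem circleExp_re_lipschitz (x y : UnitAddCircle) :
    |(circleExp x).re - (circleExp y).re| ≤ 2 * Real.pi * ‖x - y‖ := by
  rw [← Complex.sub_re]
  refine (Complex.abs_re_le_norm _).trans ?_
  have e : circleExp x - circleExp y = circleExp y * (circleExp (x - y) - 1) := by
    rw [mul_sub, ← circleExp_add, add_sub_cancel, mul_one]
  rw [e, norm_mul, norm_circleExp, one_mul]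
  obtain ⟨t, ht⟩ := QuotientAddGroup.mk_surjective (x - y)
  change (t : UnitAddCircle) = x - y at ht
  rw [← ht, circleExp_coe, UnitAddCircle.norm_eq]
  have := norm_phase_sub_one_le (t - round t)
  rwa [← phase_add_intCast (t - round t) (round t), sub_add_cancel] at this

theorem integrable_circle {E : Type*} [NormedAddCommGroup E] {F : UnitAddCircle → E}
    (hF : Continuous F) : Integrable F volume := by
  exact hF.integrable_of_hasCompactSupport (HasCompactSupport.of_compactSpace F)

theorem volume_univ_unitAddCircle : (volume : Measure UnitAddCircle).real univ = 1 := by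
  simp [Measure.real, AddCircle.measure_univ]

theorem integral_circleExp_mul_re :
    ∫ z : UnitAddCircle, circleExp z * ((circleExp z).re : ℂ) = 1 / 2 := by
  have h0 : ∫ z : UnitAddCircle, circleExp z ^ 2 = 0 := by
    have h := integral_add_right_eq_self (μ := (volume : Measure UnitAddCircle))
      (fun z => circleExp z ^ 2) (((1 / 4 : ℝ) : ℝ) : UnitAddCircle)
    have e : ∀ z : UnitAddCircle,
        circleExp (z + ((1 / 4 : ℝ) : UnitAddCircle)) ^ 2 = - circleExp z ^ 2 := fun z => by
      have h2 : phase (1 / 4) ^ 2 = -1 := by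
        rw [← phase_nat_mul, phase,
          show Complex.I * ((2 * Real.pi * ((2 : ℕ) * (1 / 4)) : ℝ) : ℂ) = Real.pi * Complex.I by
            push_cast; ring, Complex.exp_pi_mul_I]
      rw [circleExp_add, circleExp_coe, mul_pow, h2, mul_neg_one]
    simp only [e, integral_neg] at h
    exact self_eq_neg.1 h.symm
  have e : ∀ z : UnitAddCircle, circleExp z * ((circleExp z).re : ℂ) =
      (1 / 2 : ℂ) * circleExp z ^ 2 + 1 / 2 := fun z => by
    have h1 : circleExp z * (starRingEnd ℂ) (circleExp z) = 1 := by
      rw [Complex.mul_conj, Complex.normSq_eq_norm_sq, norm_circleExp]; norm_num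
    rw [Complex.re_eq_add_conj]
    linear_combination (1 / 2 : ℂ) * h1
  simp only [e]
  have hc := continuous_circleExp
  rw [integral_add (integrable_circle (by fun_prop)) (integrable_circle (by fun_prop)),
    integral_const_mul, h0, integral_const,
    volume_univ_unitAddCircle]
  simp

/-- Average over the translates by 0, c and 2c: `P` is unchanged and `G` cancels. -/
theorem integral_mul_eq_zero_of_third_shift {G : UnitAddCircle → ℝ} {P : UnitAddCircle → ℂ}
    (hG : Continuous G) (hP : Continuous P) {c : UnitAddCircle} (hPc : ∀ x, P (x + c) = P x)
    (hGc : ∀ x, G x + G (x + c) + G (x + c + c) = 0) : ∫ x, (G x : ℂ) * P x = 0 := by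
  have h1 := integral_add_right_eq_self (μ := (volume : Measure UnitAddCircle))
      (fun x => (G x : ℂ) * P x) c
  have h2 := integral_add_right_eq_self (μ := (volume : Measure UnitAddCircle))
      (fun x => (G x : ℂ) * P x) (c + c)
  simp only [← add_assoc, hPc] at h1 h2
  have i0 := integrable_circle ((Complex.continuous_ofReal.comp hG).mul hP)
  have i1 := integrable_circle ((Complex.continuous_ofReal.comp
    (hG.comp (continuous_add_const c))).mul hP)
  have i2 := integrable_circle ((Complex.continuous_ofReal.comp
    (hG.comp ((continuous_add_const c).comp (continuous_add_const c)))).mul hP)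
  have h3 := integral_add (i0.add i1) i2
  rw [integral_add' i0 i1] at h3
  have h4 : ∫ x, (((fun x => (G x : ℂ) * P x) + fun x => (G (x + c) : ℂ) * P x) x +
      (G (x + c + c) : ℂ) * P x) = 0 := by
    have : ∀ x, ((fun x => (G x : ℂ) * P x) + fun x => (G (x + c) : ℂ) * P x) x +
      (G (x + c + c) : ℂ) * P x = 0 := fun x => by
      have := hGc x
      have h5 : (G x : ℂ) + G (x + c) + G (x + c + c) = 0 := by exact_mod_cast this
      simp only [Pi.add_apply]
      linear_combination P x * h5
    simp only [this, integral_zero]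
  have h5 := h4.symm.trans h3
  change (0 : ℂ) = (∫ x, (G x : ℂ) * P x) + (∫ x, (G (x + c) : ℂ) * P x) +
    ∫ x, (G (x + c + c) : ℂ) * P x at h5
  rw [h1, h2] at h5
  linear_combination (-1 / 3 : ℂ) * h5

/-- The product of the two trigonometric factors is A² + Re e(a) plus terms of frequencies 1 and 2,
collected in `G`. These frequencies are not divisible by 3, so they are orthogonal to the
1/3-periodic `P`. The factor √2 gives Re e(a) the coefficient 1. -/
theorem integral_autocorrelation {P : UnitAddCircle → ℂ} (hP : Continuous P)
    (hPc : ∀ x, P (x + ((1 / 3 : ℝ) : UnitAddCircle)) = P x) (A : ℝ) (a : UnitAddCircle) :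
    ∫ x, (((A + √2 * (circleExp (x + a)).re) * (A + √2 * (circleExp x).re) : ℝ) : ℂ) * P x =
      ((A ^ 2 + (circleExp a).re : ℝ) : ℂ) * ∫ x, P x := by
  set w := circleExp a
  set G : UnitAddCircle → ℝ := fun x => A * √2 * ((w + 1) * circleExp x).re +
    (w * circleExp x ^ 2).re
  have hG : Continuous G := by
    have := continuous_circleExp
    exact (continuous_const.mul (Complex.continuous_re.comp (by fun_prop))).add
      (Complex.continuous_re.comp (by fun_prop))
  have hω : 1 + phase (1 / 3) + phase (1 / 3) ^ 2 = 0 := by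
    have h3 : phase (1 / 3) ^ 3 = 1 := by
      rw [← phase_nat_mul, show ((3 : ℕ) : ℝ) * (1 / 3) = ((1 : ℤ) : ℝ) by norm_num, phase_intCast]
    have hne : phase (1 / 3) - 1 ≠ 0 := by
      rw [← norm_pos_iff]
      refine lt_of_lt_of_le ?_ (le_norm_phase_sub_one (t := 1 / 3) ?_)
      · norm_num
      · rw [abs_of_pos] <;> norm_num
    have : (phase (1 / 3) - 1) * (1 + phase (1 / 3) + phase (1 / 3) ^ 2) = 0 := by
      linear_combination h3
    exact (mul_eq_zero.1 this).resolve_left hne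
  have hGc : ∀ x, G x + G (x + ((1 / 3 : ℝ) : UnitAddCircle)) +
      G (x + ((1 / 3 : ℝ) : UnitAddCircle) + ((1 / 3 : ℝ) : UnitAddCircle)) = 0 := fun x => by
    simp only [G, circleExp_add, circleExp_coe]
    set e := circleExp x
    set ω := phase (1 / 3)
    have h1 : (w + 1) * e + (w + 1) * (e * ω) + (w + 1) * (e * ω * ω) = 0 := by
      linear_combination (w + 1) * e * hω
    have h2 : w * e ^ 2 + w * (e * ω) ^ 2 + w * (e * ω * ω) ^ 2 = 0 := by
      linear_combination (w * e ^ 2) * (1 - ω + ω ^ 2) * hω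
    have h1' := congrArg Complex.re h1
    have h2' := congrArg Complex.re h2
    simp only [Complex.add_re, Complex.zero_re] at h1' h2'
    linear_combination (A * √2) * h1' + h2'
  have key : ∀ x, (((A + √2 * (circleExp (x + a)).re) * (A + √2 * (circleExp x).re) : ℝ) : ℂ) * P x =
      ((A ^ 2 + w.re : ℝ) : ℂ) * P x + (G x : ℂ) * P x := fun x => by
    rw [← add_mul, ← Complex.ofReal_add]
    congr 2
    have h2 : √2 * √2 = (2 : ℝ) := Real.mul_self_sqrt (by norm_num)
    have h1 : (circleExp x).re ^ 2 + (circleExp x).im ^ 2 = 1 := by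
      have := Complex.normSq_eq_norm_sq (circleExp x)
      rw [norm_circleExp, Complex.normSq_apply] at this
      linarith
    rw [circleExp_add]
    simp only [G, pow_two, Complex.mul_re, Complex.add_re, Complex.add_im, Complex.one_re,
      Complex.one_im, Complex.mul_im]
    linear_combination ((circleExp x).re * w.re - (circleExp x).im * w.im) * (circleExp x).re * h2 +
      w.re * h1
  simp only [key]
  rw [integral_add (integrable_circle (by fun_prop)) (integrable_circle (by fun_prop)), integral_const_mul,
    integral_mul_eq_zero_of_third_shift hG hP hPc hGc, add_zero]

/-! ### Skew products on the three-torus -/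

/-- The skew product `(x, y, z) ↦ (x + a, y + b, z + H (x, y))`. -/
noncomputable def skewPerm (a b : UnitAddCircle) (H : UnitAddCircle → UnitAddCircle → ℝ) :
    Equiv.Perm (FlatTorus 3) where
  toFun p := WithLp.toLp 2 ![p 0 + a, p 1 + b, p 2 + (H (p 0) (p 1) : UnitAddCircle)]
  invFun p := WithLp.toLp 2 ![p 0 + -a, p 1 + -b,
    p 2 + ((-H (p 0 + -a) (p 1 + -b) : ℝ) : UnitAddCircle)]
  left_inv p := by
    ext i; fin_cases i <;> simp
  right_inv p := by
    ext i; fin_cases i <;> simp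

theorem skewPerm_apply (a b : UnitAddCircle) (H : UnitAddCircle → UnitAddCircle → ℝ)
    (p : FlatTorus 3) : skewPerm a b H p =
      WithLp.toLp 2 ![p 0 + a, p 1 + b, p 2 + (H (p 0) (p 1) : UnitAddCircle)] := rfl

theorem skewPerm_symm (a b : UnitAddCircle) (H : UnitAddCircle → UnitAddCircle → ℝ) :
    (skewPerm a b H).symm = skewPerm (-a) (-b) fun x y => -H (x + -a) (y + -b) :=
  Equiv.ext fun _ => rfl

theorem skewPerm_pow (a b : UnitAddCircle) (H : UnitAddCircle → UnitAddCircle → ℝ) (n : ℕ) :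
    skewPerm a b H ^ n = skewPerm (n • a) (n • b)
      fun x y => ∑ j ∈ Finset.range n, H (x + j • a) (y + j • b) := by
  induction n with
  | zero => ext p i; fin_cases i <;> simp [skewPerm_apply]
  | succ n ih =>
    rw [pow_succ', ih]
    ext p i
    rw [Equiv.Perm.mul_apply, skewPerm_apply, skewPerm_apply, skewPerm_apply]
    fin_cases i
    · simp [add_assoc, succ_nsmul]
    · simp [add_assoc, succ_nsmul]
    · simp [add_assoc, Finset.sum_range_succ]

theorem lipConst_le_of_dist_le {f : FlatTorus 3 → FlatTorus 3} {K : ℝ} (hK : 0 ≤ K)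
    (h : ∀ p q, dist (f p) (f q) ≤ K * dist p q) : lipConst f ≤ ENNReal.ofReal K := by
  refine iSup_le fun p => iSup_le fun q => iSup_le fun _ => ENNReal.div_le_of_le_mul ?_
  rw [edist_dist, edist_dist, ← ENNReal.ofReal_mul hK]
  exact ENNReal.ofReal_le_ofReal (h p q)

theorem dist_le_of_lipConst_le {f : FlatTorus 3 → FlatTorus 3} {K : ℝ} (hK : 0 ≤ K)
    (h : lipConst f ≤ ENNReal.ofReal K) (p q : FlatTorus 3) : dist (f p) (f q) ≤ K * dist p q := by
  rcases eq_or_ne p q with rfl | hne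
  · simp
  have h1 : edist (f p) (f q) / edist p q ≤ ENNReal.ofReal K := by
    refine le_trans ?_ h
    unfold lipConst
    refine le_iSup_of_le p (le_iSup_of_le q ?_)
    exact le_iSup (fun _ : p ≠ q => edist (f p) (f q) / edist p q) hne
  rw [ENNReal.div_le_iff_le_mul (Or.inl (edist_pos.2 hne).ne') (Or.inl (edist_ne_top _ _)),
    edist_dist, edist_dist, ← ENNReal.ofReal_mul hK] at h1
  exact (ENNReal.ofReal_le_ofReal_iff (by positivity)).1 h1

theorem dist_skewPerm_le {a b : UnitAddCircle} {X Y : UnitAddCircle → ℝ} {K L : ℝ} (hK : 0 ≤ K)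
    (hL : 0 ≤ L) (hX : ∀ x x', |X x - X x'| ≤ K * ‖x - x'‖) (hY : ∀ y y', |Y y - Y y'| ≤ L * ‖y - y'‖)
    {H : UnitAddCircle → UnitAddCircle → ℝ}
    (hH : ∀ x y x' y', |H x y - H x' y'| ≤ |X x - X x'| + |Y y - Y y'|)
    (p q : FlatTorus 3) : dist (skewPerm a b H p) (skewPerm a b H q) ≤ (1 + K + L) * dist p q := by
  have e : skewPerm a b H p - skewPerm a b H q = (p - q) + WithLp.toLp 2
      ![(0 : UnitAddCircle), 0, ((H (p 0) (p 1) - H (q 0) (q 1) : ℝ) : UnitAddCircle)] := by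
    ext i; fin_cases i
    · simp [skewPerm_apply]
    · simp [skewPerm_apply]
    · simp [skewPerm_apply]; abel
  rw [dist_eq_norm, dist_eq_norm, e]
  refine (norm_add_le _ _).trans ?_
  have h1 : ‖(WithLp.toLp 2
      ![(0 : UnitAddCircle), 0, ((H (p 0) (p 1) - H (q 0) (q 1) : ℝ) : UnitAddCircle)] :
        FlatTorus 3)‖ ≤ |H (p 0) (p 1) - H (q 0) (q 1)| := by
    rw [PiLp.norm_eq_of_L2, Fin.sum_univ_three]
    simp only [Matrix.cons_val_zero, Matrix.cons_val_one, Matrix.cons_val_two, norm_zero]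
    rw [zero_pow two_ne_zero, zero_add, zero_add, Real.sqrt_sq (norm_nonneg _)]
    exact norm_coe_unitAddCircle_le _
  have h2 := hH (p 0) (p 1) (q 0) (q 1)
  have h3 := hX (p 0) (q 0)
  have h4 := hY (p 1) (q 1)
  have h5 : ‖p 0 - q 0‖ ≤ ‖p - q‖ := PiLp.norm_apply_le (p - q) 0
  have h6 : ‖p 1 - q 1‖ ≤ ‖p - q‖ := PiLp.norm_apply_le (p - q) 1
  have h7 := mul_le_mul_of_nonneg_left h5 hK
  have h8 := mul_le_mul_of_nonneg_left h6 hL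
  linarith

theorem growth_skewPerm_le {a b : UnitAddCircle} {X Y : UnitAddCircle → ℝ} {K L : ℝ} (hK : 0 ≤ K)
    (hL : 0 ≤ L) (hX : ∀ x x', |X x - X x'| ≤ K * ‖x - x'‖)
    (hY : ∀ y y', |Y y - Y y'| ≤ L * ‖y - y'‖) :
    growth (skewPerm a b fun x y => X x + Y y) ≤ ENNReal.ofReal (1 + K + L) := by
  refine max_le (lipConst_le_of_dist_le (by positivity) ?_)
    (lipConst_le_of_dist_le (by positivity) ?_)
  · refine dist_skewPerm_le hK hL hX hY fun x y x' y' => ?_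
    rw [add_sub_add_comm]; exact abs_add_le _ _
  · rw [skewPerm_symm]
    refine dist_skewPerm_le hK hL (X := fun x => X (x + -a)) (Y := fun y => Y (y + -b))
      (fun x x' => (hX _ _).trans (by rw [add_sub_add_right_eq_sub]))
      (fun x x' => (hY _ _).trans (by rw [add_sub_add_right_eq_sub])) fun x y x' y' => ?_
    rw [← abs_neg, neg_sub_neg, neg_sub, add_sub_add_comm]; exact abs_add_le _ _

/-- Locally `F` varies by less than 1/2, and there the circle distance between its values equals
their real distance. -/
theorem abs_deriv_le_lipConst {φ : FlatTorus 3 → FlatTorus 3} {γ : ℝ → FlatTorus 3}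
    (hγ : ∀ s t, dist (γ s) (γ t) ≤ |s - t|) {F : ℝ → ℝ}
    (hF : ∀ t, φ (γ t) 2 = (F t : UnitAddCircle)) {d s : ℝ} (hd : HasDerivAt F d s) :
    ENNReal.ofReal |d| ≤ lipConst φ := by
  rcases eq_or_ne (lipConst φ) ⊤ with h | h
  · rw [h]; exact le_top
  rw [← ENNReal.ofReal_toReal h]
  refine ENNReal.ofReal_le_ofReal ?_
  set L := (lipConst φ).toReal
  have hL : lipConst φ ≤ ENNReal.ofReal L := (ENNReal.ofReal_toReal h).ge
  have hL0 : 0 ≤ L := ENNReal.toReal_nonneg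
  refine hd.le_of_lip' hL0 ?_
  have hcont : ∀ᶠ t in 𝓝 s, |F t - F s| < 1 / 2 := by
    have := (Metric.tendsto_nhds.1 hd.continuousAt) (1 / 2) (by norm_num)
    simpa only [Real.dist_eq] using this
  filter_upwards [hcont] with t ht
  have h1 := dist_le_of_lipConst_le hL0 hL (γ t) (γ s)
  have h2 : ‖((F t - F s : ℝ) : UnitAddCircle)‖ ≤ dist (φ (γ t)) (φ (γ s)) := by
    rw [dist_eq_norm, AddCircle.coe_sub, ← hF, ← hF]
    exact PiLp.norm_apply_le (φ (γ t) - φ (γ s)) 2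
  have h3 : ‖((F t - F s : ℝ) : UnitAddCircle)‖ = |F t - F s| := by
    rw [AddCircle.norm_coe_eq_abs_iff 1 one_ne_zero, abs_one]; exact ht.le
  rw [h3] at h2
  exact h2.trans (h1.trans (mul_le_mul_of_nonneg_left (hγ t s) hL0))

theorem ofReal_abs_deriv_le_growth_left {a b : UnitAddCircle} {H : UnitAddCircle → UnitAddCircle → ℝ}
    {y : UnitAddCircle} {d s : ℝ} (hd : HasDerivAt (fun t : ℝ => H t y) d s) :
    ENNReal.ofReal |d| ≤ growth (skewPerm a b H) := by
  refine le_max_of_le_left (abs_deriv_le_lipConst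
    (γ := fun t => WithLp.toLp 2 ![(t : UnitAddCircle), y, 0]) (fun s t => ?_) (fun t => ?_) hd)
  · rw [dist_eq_norm, PiLp.norm_eq_of_L2, Fin.sum_univ_three]
    simp only [PiLp.sub_apply, Matrix.cons_val_zero, Matrix.cons_val_one, Matrix.cons_val, sub_self,
      norm_zero]
    rw [zero_pow two_ne_zero, add_zero, add_zero, Real.sqrt_sq (norm_nonneg _), ← AddCircle.coe_sub]
    exact norm_coe_unitAddCircle_le _
  · simp [skewPerm_apply]

theorem ofReal_abs_deriv_le_growth_right {a b : UnitAddCircle}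
    {H : UnitAddCircle → UnitAddCircle → ℝ} {x : UnitAddCircle} {d s : ℝ}
    (hd : HasDerivAt (fun t : ℝ => H x t) d s) :
    ENNReal.ofReal |d| ≤ growth (skewPerm a b H) := by
  refine le_max_of_le_left (abs_deriv_le_lipConst
    (γ := fun t => WithLp.toLp 2 ![x, (t : UnitAddCircle), 0]) (fun s t => ?_) (fun t => ?_) hd)
  · rw [dist_eq_norm, PiLp.norm_eq_of_L2, Fin.sum_univ_three]
    simp only [PiLp.sub_apply, Matrix.cons_val_zero, Matrix.cons_val_one, Matrix.cons_val, sub_self,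
      norm_zero]
    rw [zero_pow two_ne_zero, add_zero, zero_add, Real.sqrt_sq (norm_nonneg _), ← AddCircle.coe_sub]
    exact norm_coe_unitAddCircle_le _
  · simp [skewPerm_apply]

theorem one_le_growth_skewPerm (a b : UnitAddCircle) (H : UnitAddCircle → UnitAddCircle → ℝ) :
    1 ≤ growth (skewPerm a b H) := by
  have h : HasDerivAt (fun t : ℝ => H 0 0 + t) 1 0 := by
    simpa using (hasDerivAt_id (0 : ℝ)).const_add (H 0 0)
  refine le_max_of_le_left ?_
  have := abs_deriv_le_lipConst (φ := skewPerm a b H)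
    (γ := fun t => WithLp.toLp 2 ![0, 0, (t : UnitAddCircle)]) (fun s t => ?_) (fun t => ?_) h
  · simpa using this
  · rw [dist_eq_norm, PiLp.norm_eq_of_L2, Fin.sum_univ_three]
    simp only [PiLp.sub_apply, Matrix.cons_val_zero, Matrix.cons_val_one, Matrix.cons_val, sub_self,
      norm_zero]
    rw [zero_pow two_ne_zero, zero_add, zero_add, Real.sqrt_sq (norm_nonneg _), ← AddCircle.coe_sub]
    exact norm_coe_unitAddCircle_le _
  · simp [skewPerm_apply, add_comm]

/-! ### Measure, correlations and analyticity of skew products -/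

theorem integral_torusMeasure {E : Type*} [NormedAddCommGroup E] [NormedSpace ℝ E] {d : ℕ}
    (F : FlatTorus d → E) :
    ∫ p, F p ∂torusMeasure d = ∫ v : Fin d → UnitAddCircle, F (WithLp.toLp 2 v) :=
  integral_map_equiv (MeasurableEquiv.toLp 2 (Fin d → UnitAddCircle)) F

/-- With coordinate 2 split off, the map translates the base and translates each fibre. -/
theorem measurePreserving_skewPerm (a b : UnitAddCircle) {H : UnitAddCircle → UnitAddCircle → ℝ}
    (hH : Continuous (Function.uncurry H)) :
    MeasurePreserving (skewPerm a b H) (torusMeasure 3) (torusMeasure 3) := by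
  let e : (Fin 3 → UnitAddCircle) ≃ᵐ UnitAddCircle × (Fin 2 → UnitAddCircle) :=
    MeasurableEquiv.piFinSuccAbove (fun _ => UnitAddCircle) 2
  have he : MeasurePreserving e volume volume :=
    volume_preserving_piFinSuccAbove (fun _ : Fin 3 => UnitAddCircle) 2
  let t : FlatTorus 3 ≃ᵐ (Fin 3 → UnitAddCircle) :=
    (MeasurableEquiv.toLp 2 (Fin 3 → UnitAddCircle)).symm
  have ht : MeasurePreserving t.symm volume (torusMeasure 3) := ⟨t.symm.measurable, rfl⟩
  have hsk : MeasurePreserving (fun p : (Fin 2 → UnitAddCircle) × UnitAddCircle =>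
      (p.1 + ![a, b], p.2 + ((H (p.1 0) (p.1 1) : ℝ) : UnitAddCircle)))
      (volume.prod volume) (volume.prod volume) := by
    refine MeasurePreserving.skew_product (f := fun v => v + ![a, b])
      (g := fun v z => z + ((H (v 0) (v 1) : ℝ) : UnitAddCircle))
      (measurePreserving_add_right _ _) ?_ (Eventually.of_forall fun v => ?_)
    · refine Continuous.measurable (continuous_snd.add ((AddCircle.continuous_mk' 1).comp ?_))
      exact hH.comp (by fun_prop :
        Continuous fun x : (Fin 2 → UnitAddCircle) × UnitAddCircle => (x.1 0, x.1 1))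
    · exact (measurePreserving_add_right volume _).map_eq
  have hall := ht.comp ((he.symm e).comp (Measure.measurePreserving_swap.comp
    (hsk.comp (Measure.measurePreserving_swap.comp (he.comp (ht.symm t.symm))))))
  convert hall using 1
  ext p i
  fin_cases i
  · rfl
  · rfl
  · rfl

theorem isAnalyticMap_skewPerm (α β : ℝ) {H : UnitAddCircle → UnitAddCircle → ℝ} {K : ℝ → ℝ → ℝ}
    (hK : ∀ s t : ℝ, H s t = K s t)
    (ha : AnalyticOnNhd ℝ (fun x : EuclideanSpace ℝ (Fin 3) => K (x 0) (x 1)) univ) :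
    IsAnalyticMap (skewPerm α β H) := by
  refine ⟨fun x => WithLp.toLp 2 ![x 0 + α, x 1 + β, x 2 + K (x 0) (x 1)], fun x _ => ?_,
    fun x => ?_⟩
  · have hp : ∀ i, AnalyticAt ℝ (fun y : EuclideanSpace ℝ (Fin 3) => y i) x := fun i =>
      (EuclideanSpace.proj (𝕜 := ℝ) i).analyticAt x
    refine ((PiLp.continuousLinearEquiv 2 ℝ (fun _ : Fin 3 => ℝ)).symm.analyticAt _).comp
      (f := fun x : EuclideanSpace ℝ (Fin 3) => ![x 0 + α, x 1 + β, x 2 + K (x 0) (x 1)]) ?_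
    refine analyticAt_pi_iff.2 fun i => ?_
    fin_cases i
    · exact (hp 0).add analyticAt_const
    · exact (hp 1).add analyticAt_const
    · exact (hp 2).add (ha x (mem_univ _))
  · ext i; fin_cases i
    · simp [torusProj, skewPerm_apply]
    · simp [torusProj, skewPerm_apply]
    · simp [torusProj, skewPerm_apply, hK]

theorem isAnalyticDiffeo_skewPerm (α β : ℝ) {X Y : ℝ → ℝ} (hX : Function.Periodic X 1)
    (hY : Function.Periodic Y 1) (aX : AnalyticOnNhd ℝ X univ) (aY : AnalyticOnNhd ℝ Y univ) :
    IsAnalyticDiffeo (skewPerm α β fun x y => hX.lift x + hY.lift y) := by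
  have hp : ∀ (i : Fin 3) x, AnalyticAt ℝ (fun y : EuclideanSpace ℝ (Fin 3) => y i) x := fun i x =>
      (EuclideanSpace.proj (𝕜 := ℝ) i).analyticAt x
  constructor
  · refine isAnalyticMap_skewPerm α β (K := fun s t => X s + Y t) (fun s t => rfl) fun x _ => ?_
    exact ((aX _ (mem_univ _)).comp (hp 0 x)).add ((aY _ (mem_univ _)).comp (hp 1 x))
  · rw [skewPerm_symm, ← AddCircle.coe_neg, ← AddCircle.coe_neg]
    refine isAnalyticMap_skewPerm (-α) (-β) (K := fun s t => -(X (s + -α) + Y (t + -β)))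
      (fun s t => rfl) fun x _ => ?_
    exact (((aX _ (mem_univ _)).comp ((hp 0 x).add analyticAt_const)).add
      ((aY _ (mem_univ _)).comp ((hp 1 x).add analyticAt_const))).neg

theorem isSkewProduct_skewPerm (a b : UnitAddCircle) {X Y : ℝ → ℝ} (hX : Function.Periodic X 1)
    (hY : Function.Periodic Y 1) (aX : AnalyticOnNhd ℝ X univ) (aY : AnalyticOnNhd ℝ Y univ) :
    IsSkewProduct (skewPerm a b fun x y => hX.lift x + hY.lift y) := by
  have hp : ∀ (i : Fin 2) x, AnalyticAt ℝ (fun y : EuclideanSpace ℝ (Fin 2) => y i) x := fun i x =>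
      (EuclideanSpace.proj (𝕜 := ℝ) i).analyticAt x
  exact ⟨a, b, fun p => hX.lift (p 0) + hY.lift (p 1), fun x _ =>
    ((aX _ (mem_univ _)).comp (hp 0 x)).add ((aY _ (mem_univ _)).comp (hp 1 x)), fun p => rfl⟩

/-- The observable `(x, y, z) ↦ ε (A + √2 cos 2πx) cos 2πz`. -/
noncomputable def observable (ε A : ℝ) (p : FlatTorus 3) : ℝ :=
  ε * (A + √2 * (circleExp (p 0)).re) * (circleExp (p 2)).re

theorem isAnalyticFun_observable (ε A : ℝ) : IsAnalyticFun (observable ε A) := by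
  intro x _
  have hp : ∀ i, AnalyticAt ℝ (fun y : EuclideanSpace ℝ (Fin 3) => y i) x := fun i =>
      (EuclideanSpace.proj (𝕜 := ℝ) i).analyticAt x
  have h : ∀ i, AnalyticAt ℝ
      (fun y : EuclideanSpace ℝ (Fin 3) => Real.cos (2 * Real.pi * y i)) x := fun i =>
    Real.analyticAt_cos.comp (analyticAt_const.mul (hp i))
  refine ((analyticAt_const (v := ε)).mul ((analyticAt_const (v := A)).add
    ((analyticAt_const (v := √2)).mul (h 0)))).mul (h 2) |>.congr (Eventually.of_forall fun y => ?_)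
  change _ = ε * (A + √2 * (circleExp (y 0 : UnitAddCircle)).re) *
    (circleExp (y 2 : UnitAddCircle)).re
  rw [circleExp_coe, circleExp_coe, phase_re, phase_re]
  rfl

theorem observable_ne_zero {ε A : ℝ} (hε : ε ≠ 0) (hA : 0 ≤ A) : observable ε A ≠ 0 := by
  intro h
  have h0 := congrFun h 0
  have e : circleExp 0 = 1 := by rw [← AddCircle.coe_zero, circleExp_coe, phase_zero]
  simp only [observable, PiLp.zero_apply, e, Complex.one_re, mul_one, Pi.zero_apply] at h0
  have : 0 < A + √2 := by positivity
  exact (mul_ne_zero hε this.ne') h0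

theorem abs_circleExp_re_le (x : UnitAddCircle) : |(circleExp x).re| ≤ 1 :=
  (Complex.abs_re_le_norm _).trans (norm_circleExp x).le

theorem lipschitz_observable (ε A : ℝ) : ∃ K : NNReal, LipschitzWith K (observable ε A) := by
  refine ⟨(|ε| * ((|A| + √2) + √2) * (2 * Real.pi)).toNNReal,
    LipschitzWith.of_dist_le_mul fun p q => ?_⟩
  rw [Real.coe_toNNReal _ (by positivity), Real.dist_eq, dist_eq_norm]
  have h5 : ‖p 0 - q 0‖ ≤ ‖p - q‖ := PiLp.norm_apply_le (p - q) 0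
  have h6 : ‖p 2 - q 2‖ ≤ ‖p - q‖ := PiLp.norm_apply_le (p - q) 2
  have h0 := (circleExp_re_lipschitz (p 0) (q 0)).trans (mul_le_mul_of_nonneg_left h5 (by positivity))
  have h2 := (circleExp_re_lipschitz (p 2) (q 2)).trans (mul_le_mul_of_nonneg_left h6 (by positivity))
  have hc := abs_circleExp_re_le (p 0)
  have hd := abs_circleExp_re_le (q 2)
  simp only [observable]
  set c := (circleExp (p 0)).re
  set c' := (circleExp (q 0)).re
  set d := (circleExp (p 2)).re
  set d' := (circleExp (q 2)).re
  have e : ε * (A + √2 * c) * d - ε * (A + √2 * c') * d' =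
      ε * ((A + √2 * c) * (d - d') + √2 * (c - c') * d') := by ring
  have b1 : |A + √2 * c| ≤ |A| + √2 := by
    refine (abs_add_le A (√2 * c)).trans ?_
    rw [abs_mul, abs_of_nonneg (Real.sqrt_nonneg 2)]
    have := mul_le_mul_of_nonneg_left hc (Real.sqrt_nonneg 2)
    linarith
  have b2 : |(A + √2 * c) * (d - d') + √2 * (c - c') * d'| ≤
      ((|A| + √2) + √2) * (2 * Real.pi * ‖p - q‖) := by
    refine (abs_add_le ((A + √2 * c) * (d - d')) (√2 * (c - c') * d')).trans ?_
    rw [abs_mul, abs_mul, abs_mul, abs_of_nonneg (Real.sqrt_nonneg 2)]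
    calc |A + √2 * c| * |d - d'| + √2 * |c - c'| * |d'|
        ≤ (|A| + √2) * (2 * Real.pi * ‖p - q‖) + √2 * (2 * Real.pi * ‖p - q‖) * 1 := by gcongr
      _ = _ := by ring
  rw [e, abs_mul]
  calc |ε| * |(A + √2 * c) * (d - d') + √2 * (c - c') * d'|
      ≤ |ε| * (((|A| + √2) + √2) * (2 * Real.pi * ‖p - q‖)) := by gcongr
    _ = _ := by ring

theorem integral_circleExp_re : ∫ z : UnitAddCircle, (circleExp z).re = 0 := by
  have h := integral_add_right_eq_self (μ := (volume : Measure UnitAddCircle))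
    (fun z => (circleExp z).re) ((1 / 2 : ℝ) : UnitAddCircle)
  have h2 : phase (1 / 2) = -1 := by
    rw [phase, show Complex.I * ((2 * Real.pi * (1 / 2) : ℝ) : ℂ) = Real.pi * Complex.I by
      push_cast; ring, Complex.exp_pi_mul_I]
  simp only [circleExp_add, circleExp_coe, h2, mul_neg_one, Complex.neg_re, integral_neg] at h
  exact self_eq_neg.1 h.symm

theorem integral_observable (ε A : ℝ) : ∫ p, observable ε A p ∂torusMeasure 3 = 0 := by
  rw [integral_torusMeasure]
  have h := integral_fintype_prod_volume_eq_prod (𝕜 := ℝ) (ι := Fin 3) (E := fun _ => UnitAddCircle)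
    ![fun x => ε * (A + √2 * (circleExp x).re), fun _ => 1, fun z => (circleExp z).re]
  simp only [Fin.prod_univ_three, Matrix.cons_val_zero, Matrix.cons_val_one, Matrix.cons_val] at h
  rw [integral_circleExp_re, mul_zero] at h
  simpa [observable] using h

/-- Since the cocycle is a sum of a function of x and a function of y, the integrand is ε² times the
real part of a product U(x)V(y)W(z), which Fubini separates. -/
theorem integral_observable_comp_mul {a b : UnitAddCircle} {X Y : UnitAddCircle → ℝ}
    (hX : Continuous X) (hY : Continuous Y)
    (hXp : ∀ x, X (x + ((1 / 3 : ℝ) : UnitAddCircle)) = X x) (ε A : ℝ) :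
    ∫ p, observable ε A (skewPerm a b (fun x y => X x + Y y) p) * observable ε A p ∂torusMeasure 3 =
      (ε ^ 2 / 2) * (((A ^ 2 + (circleExp a).re : ℝ) : ℂ) *
        (∫ x, circleExp (X x : UnitAddCircle)) * ∫ y, circleExp (Y y : UnitAddCircle)).re := by
  have hcX : Continuous fun x => circleExp (X x : UnitAddCircle) :=
    continuous_circleExp.comp ((AddCircle.continuous_mk' 1).comp hX)
  have hcY : Continuous fun x => circleExp (Y x : UnitAddCircle) :=
    continuous_circleExp.comp ((AddCircle.continuous_mk' 1).comp hY)
  have hc := continuous_circleExp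
  set U : UnitAddCircle → ℂ := fun x =>
    (((A + √2 * (circleExp (x + a)).re) * (A + √2 * (circleExp x).re) : ℝ) : ℂ) *
      circleExp (X x : UnitAddCircle)
  set V : UnitAddCircle → ℂ := fun y => circleExp (Y y : UnitAddCircle)
  set W : UnitAddCircle → ℂ := fun z => circleExp z * ((circleExp z).re : ℂ)
  have hU : ∫ x, U x = ((A ^ 2 + (circleExp a).re : ℝ) : ℂ) * ∫ x, circleExp (X x : UnitAddCircle) :=
    integral_autocorrelation hcX (fun x => by rw [hXp]) A a
  have hW : ∫ z, W z = 1 / 2 := integral_circleExp_mul_re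
  have hprod := integral_fintype_prod_volume_eq_prod (𝕜 := ℂ) (ι := Fin 3)
    (E := fun _ => UnitAddCircle) ![U, V, W]
  simp only [Fin.prod_univ_three, Matrix.cons_val_zero, Matrix.cons_val_one, Matrix.cons_val]
    at hprod
  rw [hU, hW] at hprod
  rw [integral_torusMeasure]
  have hUc : Continuous U := by
    refine (Complex.continuous_ofReal.comp ?_).mul hcX
    exact (continuous_const.add (continuous_const.mul (Complex.continuous_re.comp (by fun_prop)))).mul
      (continuous_const.add (continuous_const.mul (Complex.continuous_re.comp hc)))
  have hWc : Continuous W := hc.mul (Complex.continuous_ofReal.comp (Complex.continuous_re.comp hc))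
  have hcont : Continuous fun v : Fin 3 → UnitAddCircle => U (v 0) * V (v 1) * W (v 2) := by
    fun_prop
  have hint : Integrable (fun v : Fin 3 → UnitAddCircle => U (v 0) * V (v 1) * W (v 2)) volume :=
    hcont.integrable_of_hasCompactSupport (HasCompactSupport.of_compactSpace _)
  have hre := integral_re hint
  rw [hprod] at hre
  have e : ∀ v : Fin 3 → UnitAddCircle,
      observable ε A (skewPerm a b (fun x y => X x + Y y) (WithLp.toLp 2 v)) *
        observable ε A (WithLp.toLp 2 v) = ε ^ 2 * RCLike.re (U (v 0) * V (v 1) * W (v 2)) := fun v => by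
    have h1 : U (v 0) * V (v 1) * W (v 2) =
        (((A + √2 * (circleExp (v 0 + a)).re) * (A + √2 * (circleExp (v 0)).re) *
          (circleExp (v 2)).re : ℝ) : ℂ) *
          circleExp (v 2 + ((X (v 0) + Y (v 1) : ℝ) : UnitAddCircle)) := by
      simp only [U, V, W]
      rw [circleExp_add (v 2), AddCircle.coe_add, circleExp_add (X (v 0) : UnitAddCircle)]
      push_cast
      ring
    rw [h1]
    simp only [RCLike.re_to_complex, Complex.re_ofReal_mul]
    simp only [observable, skewPerm_apply, Matrix.cons_val_zero, Matrix.cons_val]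
    ring
  simp only [e]
  rw [integral_const_mul, hre]
  simp only [RCLike.re_to_complex]
  rw [show ((A ^ 2 + (circleExp a).re : ℝ) : ℂ) * (∫ x, circleExp (X x : UnitAddCircle)) *
      (∫ y, V y) * (1 / 2) = ((1 / 2 : ℝ) : ℂ) * (((A ^ 2 + (circleExp a).re : ℝ) : ℂ) *
        (∫ x, circleExp (X x : UnitAddCircle)) * (∫ y, V y)) by push_cast; ring,
    Complex.re_ofReal_mul]
  ring

theorem norm_integral_circleExp_le_one (X : UnitAddCircle → ℝ) :
    ‖∫ x, circleExp (X x : UnitAddCircle)‖ ≤ 1 := by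
  have h := norm_integral_le_of_norm_le_const (μ := (volume : Measure UnitAddCircle))
    (f := fun x => circleExp (X x : UnitAddCircle)) (C := 1)
    (Eventually.of_forall fun x => (norm_circleExp _).le)
  rwa [volume_univ_unitAddCircle, mul_one] at h

theorem integral_circleExp_lift {F : ℝ → ℝ} (hF : Function.Periodic F 1) :
    ∫ x : UnitAddCircle, circleExp (hF.lift x : UnitAddCircle) = ∫ t in (0 : ℝ)..1, phase (F t) := by
  have h := UnitAddCircle.intervalIntegral_preimage 0
    (fun x : UnitAddCircle => circleExp (hF.lift x : UnitAddCircle))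
  rw [zero_add] at h
  rw [← h]
  exact intervalIntegral.integral_congr fun t _ => circleExp_coe (F t)

/-! ### Concave rates -/

/-- Concave increasing unbounded functions with `1 ≤ u 1` and `u x ≤ x ^ (3 / 4)`. -/
structure IsRate (u : ℝ → ℝ) : Prop where
  nonneg : ∀ x : ℝ, 0 ≤ x → 0 ≤ u x
  concave : ConcaveOn ℝ (Ici (0 : ℝ)) u
  mono : MonotoneOn u (Ici (0 : ℝ))
  tendsto : Tendsto u atTop atTop
  one : 1 ≤ u 1
  le : ∀ x : ℝ, 1 ≤ x → u x ≤ x ^ (3 / 4 : ℝ)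

namespace IsRate
variable {u : ℝ → ℝ} (hu : IsRate u)
include hu

theorem one_le {x : ℝ} (hx : 1 ≤ x) : 1 ≤ u x :=
  hu.one.trans (hu.mono (mem_Ici.2 zero_le_one) (mem_Ici.2 (zero_le_one.trans hx)) hx)

theorem le_self {x : ℝ} (hx : 1 ≤ x) : u x ≤ x := by
  refine (hu.le x hx).trans ?_
  conv_rhs => rw [← Real.rpow_one x]
  exact Real.rpow_le_rpow_of_exponent_le hx (by norm_num)

theorem eq_one : u 1 = 1 :=
  le_antisymm (hu.le_self le_rfl) hu.one

/-- That is, u(x)/x is nonincreasing: concavity between 0 and `y`, with `u 0 ≥ 0`. -/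
theorem mul_le_mul {x y : ℝ} (hx : 0 < x) (hxy : x ≤ y) : x * u y ≤ y * u x := by
  have hy : 0 < y := hx.trans_le hxy
  have hcc := hu.concave.2
  have h := hcc (mem_Ici.2 hy.le) (mem_Ici.2 le_rfl) (a := x / y) (b := 1 - x / y)
    (by positivity) (by rw [sub_nonneg, div_le_one hy]; exact hxy) (by ring)
  rw [smul_zero, add_zero, smul_eq_mul, smul_eq_mul, smul_eq_mul, div_mul_cancel₀ _ hy.ne'] at h
  have h0 : 0 ≤ (1 - x / y) * u 0 :=
    mul_nonneg (by rw [sub_nonneg, div_le_one hy]; exact hxy) (hu.nonneg 0 le_rfl)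
  have h1 : x / y * u y ≤ u x := by linarith
  rw [div_mul_eq_mul_div, div_le_iff₀ hy] at h1
  linarith

/-- If `u 2 ≤ 1`, concavity fails on [1, y] for any y > 2 with u(y) > 1. This keeps log u(n)
positive for n ≥ 2. -/
theorem one_lt {x : ℝ} (hx : 2 ≤ x) : 1 < u x := by
  refine lt_of_lt_of_le ?_ (hu.mono (mem_Ici.2 zero_le_two) (mem_Ici.2 (by linarith)) hx)
  by_contra hcon
  push Not at hcon
  obtain ⟨y, hy2, hy1⟩ := ((eventually_gt_atTop 2).and (hu.tendsto.eventually_gt_atTop 1)).exists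
  have hy : 0 < y - 1 := by linarith
  have hcc := hu.concave.2
  have h := hcc (mem_Ici.2 zero_le_one) (mem_Ici.2 (by linarith : 0 ≤ y))
    (a := 1 - 1 / (y - 1)) (b := 1 / (y - 1))
    (by rw [sub_nonneg, div_le_one hy]; linarith) (by positivity) (by ring)
  have e : (1 - 1 / (y - 1)) • (1 : ℝ) + (1 / (y - 1)) • y = 2 := by
    simp only [smul_eq_mul]; field_simp; ring
  rw [e, hu.eq_one, smul_eq_mul, smul_eq_mul] at h
  have h3 : 1 / (y - 1) * 1 < 1 / (y - 1) * u y := mul_lt_mul_of_pos_left hy1 (by positivity)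
  linarith

/-- Here the exponent 3/4 enters: u(x)/x ≤ x^{-1/4}, while x^{3/4} ≥ exp(100V) forces x^{1/4} ≥
exp(33V). All smallness of the amplitudes comes from this. -/
theorem div_le_exp_neg {x V : ℝ} (hx : 1 ≤ x) (hV : Real.exp (100 * V) ≤ u x) (hV0 : 0 ≤ V) :
    u x / x ≤ Real.exp (-(33 * V)) := by
  have hx0 : 0 < x := by linarith
  set r := x ^ (1 / 4 : ℝ)
  have hr0 : 0 < r := by positivity
  have h3 : r ^ 3 = x ^ (3 / 4 : ℝ) := by
    rw [← Real.rpow_natCast, ← Real.rpow_mul hx0.le]; norm_num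
  have h4 : r ^ 4 = x := by
    rw [← Real.rpow_natCast, ← Real.rpow_mul hx0.le]; norm_num
  have hur : u x ≤ r ^ 3 := by rw [h3]; exact hu.le x hx
  have hr : Real.exp (33 * V) ≤ r := by
    refine le_of_pow_le_pow_left₀ three_ne_zero hr0.le ?_
    rw [← Real.exp_nat_mul]
    refine le_trans (Real.exp_le_exp.2 ?_) (hV.trans hur)
    push_cast; linarith
  calc u x / x ≤ r ^ 3 / r ^ 4 := by rw [h4]; gcongr
    _ = r⁻¹ := by field_simp
    _ ≤ (Real.exp (33 * V))⁻¹ := inv_anti₀ (Real.exp_pos _) hr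
    _ = _ := (Real.exp_neg _).symm

end IsRate

/-- The finitely many early indices are absorbed by enlarging the constant. -/
theorem exists_const_mul_bound {f r : ℕ → ℝ} (hr : ∀ m, 2 ≤ m → 0 < r m) {M : ℕ} {C : ℝ}
    (h : ∀ m, M ≤ m → 2 ≤ m → f m ≤ C * r m) : ∃ C' : ℝ, 0 < C' ∧ ∀ m, 2 ≤ m → f m ≤ C' * r m := by
  have hnn : ∀ m ∈ Finset.Icc 2 M, 0 ≤ |f m| / r m := fun m hm =>
    div_nonneg (abs_nonneg _) (hr m (Finset.mem_Icc.1 hm).1).le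
  have hs := Finset.sum_nonneg hnn
  refine ⟨|C| + 1 + ∑ m ∈ Finset.Icc 2 M, |f m| / r m, by positivity, fun m hm => ?_⟩
  have hrm := hr m hm
  rcases le_total M m with hMm | hMm
  · refine (h m hMm hm).trans (mul_le_mul_of_nonneg_right ?_ hrm.le)
    linarith [le_abs_self C]
  · have h1 := Finset.single_le_sum hnn (Finset.mem_Icc.2 ⟨hm, hMm⟩)
    rw [← div_le_iff₀ hrm]
    refine (div_le_div_of_nonneg_right (le_abs_self _) hrm.le).trans (h1.trans ?_)
    linarith [abs_nonneg C]

/-! ### Towers of frequencies -/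

/-- Rapidly growing times `n` and the frequencies `q` built from them. -/
structure IsTower (u : ℝ → ℝ) (n q : ℕ → ℕ) : Prop where
  rate : IsRate u
  -- Starting from 3 makes every frequency divisible by 3 and puts the rotation number in x near
  -- 1/3.
  q_zero : q 0 = 3
  q_one : q 1 = 3
  q_add_two : ∀ k, q (k + 2) = q k * n (k + 1)
  n_zero : 100 ≤ n 0
  exp_le : ∀ k, Real.exp (100 * (n k : ℝ) ^ 2) ≤ u (n (k + 1))

theorem exists_isTower {u : ℝ → ℝ} (hu : IsRate u) : ∃ n q, IsTower u n q := by
  have hW : ∀ m : ℕ, ∃ N : ℕ, Real.exp (100 * (m : ℝ) ^ 2) ≤ u N := fun m =>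
    ((hu.tendsto.comp tendsto_natCast_atTop_atTop).eventually_ge_atTop _).exists
  choose W hW using hW
  let n : ℕ → ℕ := fun k => Nat.rec 100 (fun _ m => W m) k
  -- The state at step k is the pair (q k, q (k + 1)).
  let s : ℕ → ℕ × ℕ := fun k => Nat.rec (3, 3) (fun k x => (x.2, x.1 * n (k + 1))) k
  exact ⟨n, fun k => (s k).1, hu, rfl, rfl, fun k => rfl, le_rfl, fun k => hW _⟩

namespace IsTower
variable {u : ℝ → ℝ} {n q : ℕ → ℕ} (T : IsTower u n q)
include T

theorem one_le_n (k : ℕ) : 1 ≤ n k := by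
  induction k with
  | zero => exact le_trans (by norm_num) T.n_zero
  | succ k ih =>
    by_contra h
    have h0 : n (k + 1) = 0 := by omega
    have h1 := T.exp_le k
    rw [h0, Nat.cast_zero] at h1
    have h2 := T.rate.mono (mem_Ici.2 le_rfl) (mem_Ici.2 zero_le_one) zero_le_one
    rw [T.rate.eq_one] at h2
    have h3 : 1 < Real.exp (100 * (n k : ℝ) ^ 2) := by
      refine Real.one_lt_exp_iff.2 ?_
      have : (0 : ℝ) < n k := by exact_mod_cast ih
      positivity
    linarith

theorem sq_le_n_succ (k : ℕ) : 100 * (n k : ℝ) ^ 2 ≤ n (k + 1) := by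
  have h1 := T.rate.le_self (x := n (k + 1)) (by exact_mod_cast T.one_le_n (k + 1))
  have h2 := Real.add_one_le_exp (100 * (n k : ℝ) ^ 2)
  linarith [T.exp_le k]

theorem hundred_le_n (k : ℕ) : (100 : ℝ) ≤ n k := by
  induction k with
  | zero => exact_mod_cast T.n_zero
  | succ k ih => nlinarith [T.sq_le_n_succ k]

theorem two_mul_n_le (k : ℕ) : 2 * (n k : ℝ) ≤ n (k + 1) := by
  nlinarith [T.sq_le_n_succ k, T.hundred_le_n k]

theorem strictMono_n : StrictMono n := strictMono_nat_of_lt_succ fun k => by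
  have h1 := T.two_mul_n_le k
  have h2 := T.hundred_le_n k
  have : (n k : ℝ) < n (k + 1) := by linarith
  exact_mod_cast this

theorem sum_n_le (k : ℕ) : ∑ j ∈ Finset.range k, (n (j + 1) : ℝ) ≤ 2 * n k := by
  induction k with
  | zero => simp
  | succ k ih =>
    rw [Finset.sum_range_succ]
    linarith [T.two_mul_n_le k]

theorem exists_window {M : ℕ} (hM : n 1 ≤ M) : ∃ l, n (l + 1) ≤ M ∧ M < n (l + 2) := by
  have hex : ∃ k, M < n k := ⟨M + 1, lt_of_lt_of_le (Nat.lt_succ_self M) (T.strictMono_n.id_le _)⟩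
  classical
  have h1 := Nat.find_spec hex
  have h2 : 2 ≤ Nat.find hex := by
    by_contra h
    have h3 : Nat.find hex ≤ 1 := by omega
    have := T.strictMono_n.monotone h3
    omega
  obtain ⟨l, hl⟩ := Nat.exists_eq_add_of_le' h2
  refine ⟨l, not_lt.1 (Nat.find_min hex (by omega)), ?_⟩
  rwa [← hl]

theorem three_dvd_q (k : ℕ) : 3 ∣ q k := by
  induction k using Nat.twoStepInduction with
  | zero => rw [T.q_zero]
  | one => rw [T.q_one]
  | more k ih _ => rw [T.q_add_two]; exact ih.mul_right _

theorem one_le_q (k : ℕ) : 1 ≤ q k := by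
  induction k using Nat.twoStepInduction with
  | zero => rw [T.q_zero]; norm_num
  | one => rw [T.q_one]; norm_num
  | more k ih _ => rw [T.q_add_two]; exact Nat.mul_pos ih (T.one_le_n _)

theorem q_succ_le (k : ℕ) : (q (k + 1) : ℝ) ≤ (n k : ℝ) ^ 2 := by
  induction k using Nat.twoStepInduction with
  | zero => rw [T.q_one]; push_cast; nlinarith [T.hundred_le_n 0]
  | one =>
    rw [T.q_add_two, T.q_zero]; push_cast; nlinarith [T.hundred_le_n 1]
  | more k ih _ =>
    rw [T.q_add_two (k + 1)]
    push_cast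
    have h1 := T.sq_le_n_succ k
    have h2 : 2 * (n (k + 1) : ℝ) ≤ n (k + 2) := T.two_mul_n_le (k + 1)
    have h3 := T.hundred_le_n (k + 1)
    have h4 := T.hundred_le_n (k + 2)
    calc (q (k + 1) : ℝ) * n (k + 2) ≤ n (k + 2) * n (k + 2) := by
          refine mul_le_mul_of_nonneg_right ?_ (Nat.cast_nonneg _)
          linarith [sq_nonneg (n k : ℝ)]
      _ = _ := by ring

end IsTower

/-! ### The amplitudes and their decay -/

/-- The amplitude attached to the frequency `q k`. -/
noncomputable def amplitude (u : ℝ → ℝ) (n q : ℕ → ℕ) (k : ℕ) : ℝ := u (n k) / (q k * n k)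

namespace IsTower
variable {u : ℝ → ℝ} {n q : ℕ → ℕ} (T : IsTower u n q)
include T

theorem n_pos (k : ℕ) : (0 : ℝ) < n k := by linarith [T.hundred_le_n k]

theorem q_pos (k : ℕ) : (0 : ℝ) < q k := by exact_mod_cast T.one_le_q k

theorem one_le_q_real (k : ℕ) : (1 : ℝ) ≤ q k := by exact_mod_cast T.one_le_q k

theorem one_le_u (k : ℕ) : 1 ≤ u (n k) := T.rate.one_le (by linarith [T.hundred_le_n k])

theorem amplitude_pos (k : ℕ) : 0 < amplitude u n q k :=
  div_pos (by linarith [T.one_le_u k]) (mul_pos (T.q_pos k) (T.n_pos k))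

/-- The normalisation behind the amplitudes: at time `n k`, the k-th term of the Birkhoff sum has
derivative of order at most `u (n k)`. -/
theorem q_mul_amplitude (k : ℕ) : q k * amplitude u n q k = u (n k) / n k := by
  have := T.q_pos k
  have := T.n_pos k
  rw [amplitude]; field_simp

theorem amplitude_succ_le (k : ℕ) :
    amplitude u n q (k + 1) ≤ Real.exp (-(33 * (n k : ℝ) ^ 2)) := by
  have h1 := T.rate.div_le_exp_neg (x := n (k + 1)) (by linarith [T.hundred_le_n (k + 1)])
    (T.exp_le k) (by positivity)
  refine le_trans ?_ h1
  rw [← T.q_mul_amplitude]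
  exact le_mul_of_one_le_left (T.amplitude_pos _).le (T.one_le_q_real _)

theorem exp_neg_sq_le (k : ℕ) : Real.exp (-((n k : ℝ) ^ 2)) ≤ (1 / 2) ^ k := by
  have h1 : (k : ℝ) ≤ n k := by exact_mod_cast T.strictMono_n.id_le k
  have h2 := T.hundred_le_n k
  have h3 : Real.exp (-1) ≤ 1 / 2 := by
    rw [Real.exp_neg, ← one_div]
    refine one_div_le_one_div_of_le two_pos ?_
    have := Real.add_one_le_exp 1
    linarith
  calc Real.exp (-((n k : ℝ) ^ 2)) ≤ Real.exp (k * -1) := by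
        refine Real.exp_le_exp.2 ?_; nlinarith
    _ = Real.exp (-1) ^ k := Real.exp_nat_mul _ _
    _ ≤ (1 / 2) ^ k := by gcongr

/-- The spare factor `n k ^ 4` absorbs every time m ≤ n_k² in the tails of the Birkhoff sums. -/
theorem pow_mul_amplitude_succ_le (k : ℕ) :
    (n k : ℝ) ^ 4 * ((q (k + 1) : ℝ) ^ 2 * amplitude u n q (k + 1)) ≤ (1 / 2) ^ k := by
  set V := (n k : ℝ) ^ 2
  have hV : V ≤ Real.exp V := by linarith [Real.add_one_le_exp V]
  have hV0 : 0 ≤ V := by positivity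
  have hA := (T.amplitude_pos (k + 1)).le
  calc (n k : ℝ) ^ 4 * ((q (k + 1) : ℝ) ^ 2 * amplitude u n q (k + 1))
      = V ^ 2 * ((q (k + 1) : ℝ) ^ 2 * amplitude u n q (k + 1)) := by simp only [V]; ring
    _ ≤ Real.exp V ^ 2 * (Real.exp V ^ 2 * Real.exp (-(33 * V))) := by
        gcongr
        · exact (T.q_succ_le k).trans hV
        · exact T.amplitude_succ_le k
    _ = Real.exp (-(29 * V)) := by
        rw [← Real.exp_nat_mul, ← Real.exp_add, ← Real.exp_add]; congr 1; push_cast; ring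
    _ ≤ Real.exp (-V) := Real.exp_le_exp.2 (by linarith)
    _ ≤ _ := T.exp_neg_sq_le k

theorem amplitude_succ_mul_exp_le (k : ℕ) :
    amplitude u n q (k + 1) * Real.exp (2 * Real.pi * q (k + 1)) ≤ (1 / 2) ^ k := by
  set V := (n k : ℝ) ^ 2
  have hV0 : 0 ≤ V := by positivity
  have hq : (q (k + 1) : ℝ) ≤ V := T.q_succ_le k
  calc amplitude u n q (k + 1) * Real.exp (2 * Real.pi * q (k + 1))
      ≤ Real.exp (-(33 * V)) * Real.exp (8 * V) := by
        gcongr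
        · exact T.amplitude_succ_le k
        · nlinarith [Real.pi_lt_four, T.q_pos (k + 1)]
    _ = Real.exp (-(25 * V)) := by rw [← Real.exp_add]; congr 1; ring
    _ ≤ Real.exp (-V) := Real.exp_le_exp.2 (by linarith)
    _ ≤ _ := T.exp_neg_sq_le k

theorem sq_mul_amplitude_le (k : ℕ) : (q k : ℝ) ^ 2 * amplitude u n q k ≤ 3 := by
  rcases k with _ | k
  · have h := T.q_mul_amplitude 0
    have h1 := T.rate.le_self (x := n 0) (by linarith [T.hundred_le_n 0])
    have h2 : u (n 0) / n 0 ≤ 1 := (div_le_one (T.n_pos 0)).2 h1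
    rw [pow_two, mul_assoc, h, T.q_zero]
    push_cast; linarith
  · have h := T.pow_mul_amplitude_succ_le k
    have h1 : (1 : ℝ) ≤ (n k : ℝ) ^ 4 := one_le_pow₀ (by linarith [T.hundred_le_n k])
    have h2 : 0 ≤ (q (k + 1) : ℝ) ^ 2 * amplitude u n q (k + 1) :=
      mul_nonneg (sq_nonneg _) (T.amplitude_pos _).le
    have h3 : (1 / 2 : ℝ) ^ k ≤ 1 := pow_le_one₀ (by norm_num) (by norm_num)
    nlinarith

/-! #### The rotation numbers -/

theorem pow_mul_q_le (k i : ℕ) : 2 ^ i * (q k : ℝ) ≤ q (k + 2 * i) := by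
  induction i with
  | zero => simp
  | succ i ih =>
    rw [show k + 2 * (i + 1) = k + 2 * i + 2 by ring, T.q_add_two]
    push_cast
    have := T.hundred_le_n (k + 2 * i + 1)
    have := T.q_pos (k + 2 * i)
    rw [pow_succ]
    nlinarith

end IsTower

/-- The sum of the reciprocals of every other frequency, from the `k`-th on. -/
noncomputable def recipSum (q : ℕ → ℕ) (k : ℕ) : ℝ := ∑' i, 1 / (q (k + 2 * i) : ℝ)

/-- The distance of `q k * recipSum q (k % 2)` to the integers. -/
noncomputable def defect (q : ℕ → ℕ) (k : ℕ) : ℝ := q k * recipSum q (k + 2)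

namespace IsTower
variable {u : ℝ → ℝ} {n q : ℕ → ℕ} (T : IsTower u n q)
include T

theorem recip_le (k i : ℕ) : 1 / (q (k + 2 * i) : ℝ) ≤ 1 / q k * (1 / 2) ^ i := by
  have h := T.pow_mul_q_le k i
  have hq := T.q_pos k
  calc 1 / (q (k + 2 * i) : ℝ) ≤ 1 / (2 ^ i * q k) := by gcongr
    _ = _ := by rw [one_div_pow]; field_simp

theorem summable_recip (k : ℕ) : Summable fun i => 1 / (q (k + 2 * i) : ℝ) :=
  Summable.of_nonneg_of_le (fun _ => by positivity) (T.recip_le k)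
    (summable_geometric_two.mul_left _)

theorem recipSum_eq (k : ℕ) : recipSum q k = 1 / q k + recipSum q (k + 2) := by
  rw [recipSum, (T.summable_recip k).tsum_eq_zero_add, mul_zero, add_zero]
  congr 1
  refine tsum_congr fun i => ?_
  rw [show k + 2 * (i + 1) = k + 2 + 2 * i by ring]

theorem recipSum_pos (k : ℕ) : 0 < recipSum q k := by
  rw [T.recipSum_eq]
  have := T.q_pos k
  have : 0 ≤ recipSum q (k + 2) := tsum_nonneg fun i => by positivity
  positivity

theorem recipSum_le (k : ℕ) : recipSum q k ≤ 2 / q k := by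
  refine ((T.summable_recip k).tsum_le_tsum (T.recip_le k)
    (summable_geometric_two.mul_left _)).trans (le_of_eq ?_)
  rw [tsum_mul_left, tsum_geometric_two]; ring

theorem defect_pos (k : ℕ) : 0 < defect q k := mul_pos (T.q_pos k) (T.recipSum_pos _)

theorem n_mul_defect (k : ℕ) : n (k + 1) * defect q k = 1 + defect q (k + 2) := by
  have h : (q (k + 2) : ℝ) = q k * n (k + 1) := by rw [T.q_add_two]; push_cast; ring
  have h2 := T.recipSum_eq (k + 2)
  have := T.q_pos (k + 2)
  rw [defect, defect, ← mul_assoc, mul_comm (n (k + 1) : ℝ), ← h, h2]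
  field_simp

theorem defect_le (k : ℕ) : defect q k ≤ 2 / n (k + 1) := by
  have h : (q (k + 2) : ℝ) = q k * n (k + 1) := by rw [T.q_add_two]; push_cast; ring
  have h1 := mul_le_mul_of_nonneg_left (T.recipSum_le (k + 2)) (T.q_pos k).le
  refine h1.trans (le_of_eq ?_)
  rw [h]
  have := T.q_pos k
  have := T.n_pos (k + 1)
  field_simp

theorem le_defect (k : ℕ) : 1 / n (k + 1) ≤ defect q k := by
  rw [div_le_iff₀ (T.n_pos _), mul_comm, T.n_mul_defect]
  linarith [T.defect_pos (k + 2)]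

theorem defect_le_half (k : ℕ) : defect q k ≤ 1 / 2 := by
  refine (T.defect_le k).trans ?_
  rw [div_le_div_iff₀ (T.n_pos _) two_pos]
  linarith [T.hundred_le_n (k + 1)]

/-- Multiplying the relation for k by `n (k + 1)` gives the one for k + 2, because `n_mul_defect`
turns the defect into 1 plus the next defect. The index `k % 2` selects the rotation number of the
right parity. -/
theorem exists_q_mul_recipSum (k : ℕ) :
    ∃ m : ℤ, q k * recipSum q (k % 2) = defect q k + m := by
  induction k using Nat.twoStepInduction with
  | zero =>
    refine ⟨1, ?_⟩
    have := T.q_pos 0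
    rw [Nat.zero_mod, T.recipSum_eq, defect]; push_cast; field_simp; ring
  | one =>
    refine ⟨1, ?_⟩
    have := T.q_pos 1
    rw [Nat.mod_eq_of_lt one_lt_two, T.recipSum_eq, defect]; push_cast; field_simp; ring
  | more k ih _ =>
    obtain ⟨m, hm⟩ := ih
    refine ⟨n (k + 1) * m + 1, ?_⟩
    have h := T.n_mul_defect k
    rw [Nat.add_mod_right, T.q_add_two]
    push_cast
    linear_combination (n (k + 1) : ℝ) * hm + h

theorem rotSum_q_mul (k m : ℕ) : rotSum (q k * recipSum q (k % 2)) m = rotSum (defect q k) m := by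
  obtain ⟨z, hz⟩ := T.exists_q_mul_recipSum k
  rw [hz, rotSum_add_intCast]

theorem norm_rotSum_le_n (k m : ℕ) : ‖rotSum (q k * recipSum q (k % 2)) m‖ ≤ n (k + 1) := by
  rw [T.rotSum_q_mul]
  refine (norm_rotSum_le_inv (T.defect_pos k) (T.defect_le_half k) m).trans ?_
  have h := T.le_defect k
  have hn := T.n_pos (k + 1)
  rw [div_le_iff₀ hn] at h
  rw [div_le_iff₀ (mul_pos two_pos (T.defect_pos k))]
  linarith

/-- At this time the rotation has overshot 1 by `defect q (k + 2)`, at most twice `defect q k`, so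
the quotient of chord lengths is at most π. -/
theorem norm_rotSum_at_n_le (k : ℕ) :
    ‖rotSum (q k * recipSum q (k % 2)) (n (k + 1))‖ ≤ 4 := by
  rw [T.rotSum_q_mul]
  refine (norm_rotSum_le_near_integer (T.defect_pos k) (T.defect_le_half k) _ 1).trans ?_
  have h1 := T.n_mul_defect k
  have h2 := T.defect_le (k + 2)
  have h3 := T.le_defect k
  have hd := T.defect_pos k
  have h4 : (n (k + 1) : ℝ) ≤ n (k + 3) := by exact_mod_cast T.strictMono_n.monotone (by omega)
  have h5 : 2 / (n (k + 3) : ℝ) ≤ 2 / n (k + 1) := by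
    have := T.n_pos (k + 1)
    gcongr
  have h6 : defect q (k + 2) ≤ 2 * defect q k := by
    refine h2.trans (h5.trans ?_)
    calc 2 / (n (k + 1) : ℝ) = 2 * (1 / n (k + 1)) := by ring
      _ ≤ _ := by linarith
  rw [h1, Int.cast_one, add_sub_cancel_left, abs_of_pos (T.defect_pos _),
    div_le_iff₀ (by positivity)]
  nlinarith [Real.pi_lt_four, Real.pi_pos]

theorem le_norm_rotSum_q {k m : ℕ} (hm : 4 * m ≤ n (k + 1)) :
    2 * m / Real.pi ≤ ‖rotSum (q k * recipSum q (k % 2)) m‖ := by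
  rw [T.rotSum_q_mul]
  refine le_norm_rotSum (T.defect_pos k) ?_
  have h := mul_le_mul_of_nonneg_left (T.defect_le k) (Nat.cast_nonneg (α := ℝ) m)
  refine h.trans ?_
  have hm' : 4 * (m : ℝ) ≤ n (k + 1) := by exact_mod_cast hm
  rw [mul_div_assoc', div_le_div_iff₀ (T.n_pos _) two_pos]
  linarith

/-- The rotation number lies between 1/3 and 1/3 + 1/12, hence in (1/4, 3/4). -/
theorem cos_recipSum_neg : Real.cos (2 * Real.pi * recipSum q 0) < 0 := by
  have h1 := T.recipSum_eq 0
  have h2 := T.recipSum_pos 2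
  have h3 := T.recipSum_le 2
  have h4 : (q 2 : ℝ) = 3 * n 1 := by rw [T.q_add_two, T.q_zero]; push_cast; ring
  have h5 : 2 / (q 2 : ℝ) ≤ 1 / 12 := by
    rw [h4, div_le_div_iff₀ (by linarith [T.n_pos 1]) (by norm_num)]
    linarith [T.hundred_le_n 1]
  rw [T.q_zero] at h1
  norm_num at h1
  have hpi := Real.pi_pos
  refine Real.cos_neg_of_pi_div_two_lt_of_lt ?_ ?_
  · nlinarith
  · nlinarith

end IsTower

/-! ### The cocycle of a tower and its Birkhoff sums -/

/-- The Fourier coefficients of the part of the cocycle with frequencies of parity `p`. -/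
noncomputable def towerCoeff (u : ℝ → ℝ) (n q : ℕ → ℕ) (p j : ℕ) : ℂ :=
  if j % 2 = p then (amplitude u n q j : ℂ) else 0

/-- The Fourier coefficients of the `m`-th Birkhoff sum. -/
noncomputable def birkhoffCoeff (u : ℝ → ℝ) (n q : ℕ → ℕ) (p m j : ℕ) : ℂ :=
  towerCoeff u n q p j * rotSum (q j * recipSum q p) m

/-- The tail is dominated by 2 · 2^{-j}, with sum 4; the factor 2 comes from the index shift. -/
theorem summable_and_tsum_le {f : ℕ → ℝ} (hf : ∀ j, 0 ≤ f j) {k : ℕ}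
    (h : ∀ i, k ≤ i → f (i + 1) ≤ (1 / 2) ^ i) :
    Summable f ∧ ∑' j, f j ≤ ∑ j ∈ Finset.range (k + 1), f j + 4 := by
  have hg1 : HasSum (fun j => if j ∈ Finset.range (k + 1) then f j else 0)
      (∑ j ∈ Finset.range (k + 1), f j) := by
    have := hasSum_sum_of_ne_finset_zero (L := SummationFilter.unconditional ℕ) (s := Finset.range (k + 1))
      (f := fun j => if j ∈ Finset.range (k + 1) then f j else 0) fun j hj => if_neg hj
    convert this using 1
    exact Finset.sum_congr rfl fun j hj => (if_pos hj).symm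
  have hg := hg1.add (hasSum_geometric_two.mul_left 2)
  have hle : ∀ j, f j ≤ (if j ∈ Finset.range (k + 1) then f j else 0) + 2 * (1 / 2) ^ j := fun j => by
    split_ifs with hj
    · have : (0 : ℝ) ≤ 2 * (1 / 2) ^ j := by positivity
      linarith
    · rw [Finset.mem_range, not_lt] at hj
      obtain ⟨i, rfl⟩ : ∃ i, j = i + 1 := ⟨j - 1, by omega⟩
      refine (h i (by omega)).trans (le_of_eq ?_)
      rw [pow_succ]; ring
  have hs : Summable f := Summable.of_nonneg_of_le hf hle hg.summable
  refine ⟨hs, (hs.tsum_le_tsum hle hg.summable).trans (le_of_eq ?_)⟩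
  rw [hg.tsum_eq]; norm_num

namespace IsTower
variable {u : ℝ → ℝ} {n q : ℕ → ℕ} (T : IsTower u n q)
include T

theorem norm_towerCoeff_le (p j : ℕ) : ‖towerCoeff u n q p j‖ ≤ amplitude u n q j := by
  rw [towerCoeff]
  split_ifs
  · rw [Complex.norm_real, Real.norm_eq_abs, abs_of_pos (T.amplitude_pos j)]
  · rw [norm_zero]; exact (T.amplitude_pos j).le

theorem norm_birkhoffCoeff_le_time (p m j : ℕ) :
    ‖birkhoffCoeff u n q p m j‖ ≤ amplitude u n q j * m := by
  rw [birkhoffCoeff, norm_mul]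
  exact mul_le_mul (T.norm_towerCoeff_le p j) (norm_rotSum_le _ _) (norm_nonneg _)
    (T.amplitude_pos j).le

theorem norm_birkhoffCoeff_le_mul {p m j : ℕ} {C : ℝ} (hC : 0 ≤ C)
    (h : ‖rotSum (q j * recipSum q (j % 2)) m‖ ≤ C) :
    ‖birkhoffCoeff u n q p m j‖ ≤ amplitude u n q j * C := by
  by_cases hj : j % 2 = p
  · subst hj
    rw [birkhoffCoeff, norm_mul]
    exact mul_le_mul (T.norm_towerCoeff_le _ j) h (norm_nonneg _) (T.amplitude_pos j).le
  · rw [birkhoffCoeff, towerCoeff, if_neg hj, zero_mul, norm_zero]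
    exact mul_nonneg (T.amplitude_pos j).le hC

omit T in
theorem birkhoffCoeff_eq_zero {p m j : ℕ} (h : j % 2 ≠ p) : birkhoffCoeff u n q p m j = 0 := by
  rw [birkhoffCoeff, towerCoeff, if_neg h, zero_mul]

theorem sq_mul_norm_birkhoffCoeff_le (p m j : ℕ) :
    (q j : ℝ) ^ 2 * ‖birkhoffCoeff u n q p m j‖ ≤ 3 * n (j + 1) := by
  have h := T.norm_birkhoffCoeff_le_mul (p := p) (m := m) (j := j) (T.n_pos (j + 1)).le
    (T.norm_rotSum_le_n j m)
  calc (q j : ℝ) ^ 2 * ‖birkhoffCoeff u n q p m j‖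
      ≤ (q j : ℝ) ^ 2 * (amplitude u n q j * n (j + 1)) := by gcongr
    _ = (q j : ℝ) ^ 2 * amplitude u n q j * n (j + 1) := by ring
    _ ≤ 3 * n (j + 1) := by gcongr; exact T.sq_mul_amplitude_le j

theorem q_mul_le_sq_mul (j : ℕ) {x : ℝ} (hx : 0 ≤ x) : q j * x ≤ (q j : ℝ) ^ 2 * x :=
  mul_le_mul_of_nonneg_right (by nlinarith [T.one_le_q_real j]) hx

theorem birkhoffCoeff_tail {m i : ℕ} (hm : (m : ℝ) ≤ (n i : ℝ) ^ 2) (p : ℕ) :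
    (q (i + 1) : ℝ) ^ 2 * ‖birkhoffCoeff u n q p m (i + 1)‖ ≤ (1 / 2) ^ i := by
  have h := T.norm_birkhoffCoeff_le_time p m (i + 1)
  have hA := (T.amplitude_pos (i + 1)).le
  have h1 : (m : ℝ) ≤ (n i : ℝ) ^ 4 := by
    have : (1 : ℝ) ≤ (n i : ℝ) ^ 2 := one_le_pow₀ (by linarith [T.hundred_le_n i])
    nlinarith
  calc (q (i + 1) : ℝ) ^ 2 * ‖birkhoffCoeff u n q p m (i + 1)‖
      ≤ (q (i + 1) : ℝ) ^ 2 * (amplitude u n q (i + 1) * (n i : ℝ) ^ 4) := by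
        gcongr
        exact h.trans (by gcongr)
    _ = (n i : ℝ) ^ 4 * ((q (i + 1) : ℝ) ^ 2 * amplitude u n q (i + 1)) := by ring
    _ ≤ _ := T.pow_mul_amplitude_succ_le i

theorem n_sq_mono {i k : ℕ} (h : k ≤ i) : (n k : ℝ) ^ 2 ≤ (n i : ℝ) ^ 2 := by
  have : (n k : ℝ) ≤ n i := by exact_mod_cast T.strictMono_n.monotone h
  gcongr

theorem summable_sq_mul_birkhoffCoeff (p m : ℕ) :
    Summable fun j => (q j : ℝ) ^ 2 * ‖birkhoffCoeff u n q p m j‖ := by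
  refine (summable_and_tsum_le (k := m) (fun j => by positivity) fun i hi =>
    T.birkhoffCoeff_tail ?_ p).1
  have h1 : m ≤ n i := hi.trans (T.strictMono_n.id_le i)
  have h2 : (m : ℝ) ≤ n i := by exact_mod_cast h1
  nlinarith [T.hundred_le_n i]

theorem summable_q_mul_birkhoffCoeff (p m : ℕ) :
    Summable fun j => (q j : ℝ) * ‖birkhoffCoeff u n q p m j‖ :=
  Summable.of_nonneg_of_le (fun _ => by positivity) (fun j => T.q_mul_le_sq_mul j (norm_nonneg _))
    (T.summable_sq_mul_birkhoffCoeff p m)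

theorem summable_birkhoffCoeff (p m : ℕ) :
    Summable fun j => ‖birkhoffCoeff u n q p m j‖ :=
  Summable.of_nonneg_of_le (fun _ => by positivity)
    (fun j => le_mul_of_one_le_left (norm_nonneg _) (T.one_le_q_real j))
    (T.summable_q_mul_birkhoffCoeff p m)

theorem summable_towerCoeff_mul_exp (p : ℕ) :
    Summable fun j => ‖towerCoeff u n q p j‖ * Real.exp (2 * Real.pi * q j) := by
  refine (summable_and_tsum_le (k := 0) (fun j => by positivity) fun i _ => ?_).1
  refine le_trans ?_ (T.amplitude_succ_mul_exp_le i)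
  gcongr
  exact T.norm_towerCoeff_le _ _

theorem summable_towerCoeff (p : ℕ) : Summable fun j => ‖towerCoeff u n q p j‖ := by
  refine Summable.of_nonneg_of_le (fun _ => norm_nonneg _) (fun j => ?_)
    (T.summable_towerCoeff_mul_exp p)
  exact le_mul_of_one_le_right (norm_nonneg _) (Real.one_le_exp (by positivity))

/-! ### Size of the Birkhoff sums on each time scale -/

/-- Away from the dominating frequency the Birkhoff sum is small. -/
theorem tsum_others_le {l m : ℕ} (hm : m ≤ n (l + 2)) :
    ∑' j, (if j = l + 1 then 0 else
      (q j : ℝ) ^ 2 * ‖birkhoffCoeff u n q ((l + 1) % 2) m j‖) ≤ 7 * n l := by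
  set f : ℕ → ℝ := fun j => if j = l + 1 then 0 else
      (q j : ℝ) ^ 2 * ‖birkhoffCoeff u n q ((l + 1) % 2) m j‖
  have hf : ∀ j, 0 ≤ f j := fun j => by simp only [f]; split_ifs <;> positivity
  have hpar : ∀ j, j % 2 ≠ (l + 1) % 2 → f j = 0 := fun j hj => by
    simp only [f]
    rw [birkhoffCoeff_eq_zero hj, norm_zero, mul_zero, ite_self]
  have h := (summable_and_tsum_le (k := l + 1) hf fun i hi => ?_).2
  · refine h.trans ?_
    rw [Finset.sum_range_succ, Finset.sum_range_succ, hpar l (by omega),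
      show f (l + 1) = 0 from if_pos rfl, add_zero, add_zero]
    have h1 : ∑ j ∈ Finset.range l, f j ≤ ∑ j ∈ Finset.range l, 3 * (n (j + 1) : ℝ) := by
      refine Finset.sum_le_sum fun j hj => ?_
      have : j ≠ l + 1 := by have := Finset.mem_range.1 hj; omega
      simp only [f, if_neg this]
      exact T.sq_mul_norm_birkhoffCoeff_le _ _ _
    rw [← Finset.mul_sum] at h1
    linarith [T.sum_n_le l, T.hundred_le_n l]
  -- The term l + 2 vanishes by parity; the tail estimate at these times starts only at l + 3.
  · rcases Nat.eq_or_lt_of_le hi with rfl | hi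
    · rw [hpar _ (by omega)]; positivity
    · simp only [f]
      rw [if_neg (by omega)]
      refine T.birkhoffCoeff_tail ?_ _
      have h1 : (m : ℝ) ≤ n (l + 2) := by exact_mod_cast hm
      have h2 := T.n_sq_mono (show l + 2 ≤ i by omega)
      nlinarith [T.hundred_le_n (l + 2)]

/-- Terms below l add up to at most 6 n_l, which is at most 6 u(n_{l+1}); term l has returned and
gives at most 12; term l + 1 gives u(n_{l+1}); the tail gives 4. -/
theorem tsum_at_n_le (p l : ℕ) :
    ∑' j, (q j : ℝ) * ‖birkhoffCoeff u n q p (n (l + 1)) j‖ ≤ 23 * u (n (l + 1)) := by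
  have hle : ∀ j, (q j : ℝ) * ‖birkhoffCoeff u n q p (n (l + 1)) j‖ ≤
      (q j : ℝ) ^ 2 * ‖birkhoffCoeff u n q p (n (l + 1)) j‖ := fun j =>
    T.q_mul_le_sq_mul j (norm_nonneg _)
  have h := (summable_and_tsum_le (f := fun j => (q j : ℝ) *
    ‖birkhoffCoeff u n q p (n (l + 1)) j‖) (k := l + 1) (fun j => by positivity) fun i hi => ?_).2
  · refine h.trans ?_
    rw [Finset.sum_range_succ, Finset.sum_range_succ]
    have h1 : ∑ j ∈ Finset.range l, (q j : ℝ) * ‖birkhoffCoeff u n q p (n (l + 1)) j‖ ≤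
        ∑ j ∈ Finset.range l, 3 * (n (j + 1) : ℝ) :=
      Finset.sum_le_sum fun j _ => (hle j).trans (T.sq_mul_norm_birkhoffCoeff_le _ _ _)
    rw [← Finset.mul_sum] at h1
    have h2 : (q l : ℝ) * ‖birkhoffCoeff u n q p (n (l + 1)) l‖ ≤ 12 := by
      refine (hle l).trans ?_
      have := T.norm_birkhoffCoeff_le_mul (p := p) (by norm_num) (T.norm_rotSum_at_n_le l)
      calc _ ≤ (q l : ℝ) ^ 2 * (amplitude u n q l * 4) := by gcongr
        _ ≤ _ := by linarith [T.sq_mul_amplitude_le l]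
    have h3 : (q (l + 1) : ℝ) * ‖birkhoffCoeff u n q p (n (l + 1)) (l + 1)‖ ≤ u (n (l + 1)) := by
      have := T.norm_birkhoffCoeff_le_time p (n (l + 1)) (l + 1)
      calc _ ≤ (q (l + 1) : ℝ) * (amplitude u n q (l + 1) * n (l + 1)) := by gcongr
        _ = q (l + 1) * amplitude u n q (l + 1) * n (l + 1) := by ring
        _ = _ := by rw [T.q_mul_amplitude, div_mul_cancel₀ _ (T.n_pos _).ne']
    have h4 : (n l : ℝ) ≤ u (n (l + 1)) := by
      have := Real.add_one_le_exp (100 * (n l : ℝ) ^ 2)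
      nlinarith [T.exp_le l, T.hundred_le_n l]
    linarith [T.sum_n_le l, T.one_le_u (l + 1)]
  · refine (hle _).trans (T.birkhoffCoeff_tail ?_ _)
    have h2 := T.n_sq_mono hi
    nlinarith [T.hundred_le_n (l + 1)]

theorem tsum_le_of_le_sq (p : ℕ) {k m : ℕ} (hm : m ≤ n k ^ 2) :
    ∑' j, (q j : ℝ) * ‖birkhoffCoeff u n q p m j‖ ≤ 11 * (u (n k) * n k) := by
  have hm' : (m : ℝ) ≤ (n k : ℝ) ^ 2 := by exact_mod_cast hm
  have hle : ∀ j, (q j : ℝ) * ‖birkhoffCoeff u n q p m j‖ ≤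
      (q j : ℝ) ^ 2 * ‖birkhoffCoeff u n q p m j‖ := fun j => T.q_mul_le_sq_mul j (norm_nonneg _)
  have h := (summable_and_tsum_le (f := fun j => (q j : ℝ) * ‖birkhoffCoeff u n q p m j‖)
    (k := k) (fun j => by positivity) fun i hi =>
      (hle _).trans (T.birkhoffCoeff_tail (hm'.trans (T.n_sq_mono hi)) _)).2
  refine h.trans ?_
  rw [Finset.sum_range_succ]
  have h1 : ∑ j ∈ Finset.range k, (q j : ℝ) * ‖birkhoffCoeff u n q p m j‖ ≤
      ∑ j ∈ Finset.range k, 3 * (n (j + 1) : ℝ) :=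
    Finset.sum_le_sum fun j _ => (hle j).trans (T.sq_mul_norm_birkhoffCoeff_le _ _ _)
  rw [← Finset.mul_sum] at h1
  have hn := T.n_pos k
  have hu := T.one_le_u k
  have h3 : (q k : ℝ) * ‖birkhoffCoeff u n q p m k‖ ≤ u (n k) * n k := by
    have := T.norm_birkhoffCoeff_le_time p m k
    have hA := (T.amplitude_pos k).le
    calc _ ≤ (q k : ℝ) * (amplitude u n q k * (n k : ℝ) ^ 2) := by
          gcongr
          exact this.trans (by gcongr)
      _ = q k * amplitude u n q k * (n k : ℝ) ^ 2 := by ring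
      _ = _ := by rw [T.q_mul_amplitude]; field_simp
  nlinarith [T.sum_n_le k, T.hundred_le_n k]

/-- The size of the dominating term. -/
theorem le_norm_birkhoffCoeff {k m : ℕ} (hm : 4 * m ≤ n (k + 1)) :
    amplitude u n q k * (2 * m / Real.pi) ≤ ‖birkhoffCoeff u n q (k % 2) m k‖ := by
  rw [birkhoffCoeff, towerCoeff, if_pos rfl, norm_mul, Complex.norm_real, Real.norm_eq_abs,
    abs_of_pos (T.amplitude_pos k)]
  exact mul_le_mul_of_nonneg_left (T.le_norm_rotSum_q hm) (T.amplitude_pos k).le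

/-- By concavity, passing from n_{l+1} to m costs at most a factor 4, absorbed by one factor
exp(n_l²). -/
theorem log_u_ge {l m : ℕ} (hm : n (l + 1) ≤ 4 * m) :
    99 * (n l : ℝ) ^ 2 ≤ Real.log (u m) := by
  have hm' : (n (l + 1) : ℝ) ≤ 4 * m := by exact_mod_cast hm
  have hn := T.n_pos (l + 1)
  have hm0 : (0 : ℝ) < m := by linarith
  have h100 := T.hundred_le_n l
  have hu : u (n (l + 1)) ≤ 4 * u m := by
    rcases le_total (m : ℝ) (n (l + 1)) with h | h
    · have h1 := T.rate.mul_le_mul hm0 h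
      have h2 := T.rate.nonneg m hm0.le
      have h3 : m * u (n (l + 1)) ≤ m * (4 * u m) := by nlinarith
      exact le_of_mul_le_mul_left h3 hm0
    · have := T.rate.mono (mem_Ici.2 hn.le) (mem_Ici.2 hm0.le) h
      linarith [T.rate.nonneg m hm0.le]
  have h4 : Real.exp (99 * (n l : ℝ) ^ 2) ≤ u m := by
    have h5 : 4 ≤ Real.exp ((n l : ℝ) ^ 2) := by
      nlinarith [Real.add_one_le_exp ((n l : ℝ) ^ 2)]
    have h6 : Real.exp (100 * (n l : ℝ) ^ 2) =
        Real.exp (99 * (n l : ℝ) ^ 2) * Real.exp ((n l : ℝ) ^ 2) := by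
      rw [← Real.exp_add]; congr 1; ring
    have h7 := (T.exp_le l).trans hu
    rw [h6] at h7
    nlinarith [Real.exp_pos (99 * (n l : ℝ) ^ 2)]
  rw [Real.le_log_iff_exp_le ((Real.exp_pos _).trans_le h4)]
  exact h4

theorem norm_integral_phase_birkhoff_le {l m : ℕ} (h1 : n (l + 1) ≤ 4 * m)
    (h2 : 4 * m ≤ n (l + 2)) :
    ‖∫ x in (0 : ℝ)..1, phase (trigSum (birkhoffCoeff u n q ((l + 1) % 2) m) q x)‖ ≤
      10 * (Real.log (u m) / u m ^ (1 / 3 : ℝ)) := by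
  have h1' : (n (l + 1) : ℝ) ≤ 4 * m := by exact_mod_cast h1
  have hn := T.n_pos (l + 1)
  have hm0 : (0 : ℝ) < m := by linarith
  have h100 := T.hundred_le_n l
  have hlog := T.log_u_ge h1
  have hm1 : (1 : ℝ) ≤ m := by
    have : 1 ≤ m := by exact_mod_cast hm0
    exact_mod_cast this
  have hu0 : 0 < u m := by linarith [T.rate.one_le hm1]
  set R : ℝ := u m ^ (1 / 3 : ℝ)
  have hR0 : 0 < R := by positivity
  have hR3 : R ^ 3 = u m := by
    rw [← Real.rpow_natCast, ← Real.rpow_mul hu0.le]; norm_num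
  have hq1 := T.one_le_q_real (l + 1)
  have hq2 := T.q_succ_le l
  have hR : (n l : ℝ) ^ 8 ≤ R := by
    refine le_of_pow_le_pow_left₀ three_ne_zero hR0.le ?_
    rw [hR3]
    have h3 : Real.exp (99 * (n l : ℝ) ^ 2) ≤ u m := by
      rwa [Real.le_log_iff_exp_le hu0] at hlog
    refine le_trans ?_ h3
    have h4 : (n l : ℝ) ^ 2 ≤ Real.exp ((n l : ℝ) ^ 2) := by
      linarith [Real.add_one_le_exp ((n l : ℝ) ^ 2)]
    calc ((n l : ℝ) ^ 8) ^ 3 = ((n l : ℝ) ^ 2) ^ 12 := by ring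
      _ ≤ Real.exp ((n l : ℝ) ^ 2) ^ 12 := by gcongr
      _ = Real.exp (12 * (n l : ℝ) ^ 2) := by rw [← Real.exp_nat_mul]; push_cast; rfl
      _ ≤ _ := Real.exp_le_exp.2 (by nlinarith)
  have hRq : (n l : ℝ) ^ 6 * q (l + 1) ≤ R := by
    calc (n l : ℝ) ^ 6 * q (l + 1) ≤ (n l : ℝ) ^ 6 * (n l : ℝ) ^ 2 := by gcongr
      _ = (n l : ℝ) ^ 8 := by ring
      _ ≤ R := hR
  have hs6 : (n l : ℝ) ^ 6 / 2 ≤ R / (2 * q (l + 1)) := by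
    rw [div_le_div_iff₀ two_pos (by positivity)]; linarith
  have hbig : 14 * (n l : ℝ) ≤ (n l : ℝ) ^ 6 / 2 := by
    have : (1 : ℝ) ≤ (n l : ℝ) ^ 4 := one_le_pow₀ (by linarith)
    have h5 : (n l : ℝ) ^ 6 = (n l : ℝ) ^ 4 * (n l : ℝ) * n l := by ring
    nlinarith
  have hs : 14 * (n l : ℝ) ≤ R / (2 * q (l + 1)) := hbig.trans hs6
  have hs1 : 1 ≤ R / (2 * q (l + 1)) := by linarith
  -- With s = R/(2q), s³ ≤ u(m)/(8q), and the dominating coefficient is at least Am/2 ≥ u(m)/(8q),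
  -- since u(m) ≤ 4mqA.
  have hdom : (R / (2 * q (l + 1))) ^ 3 ≤ ‖birkhoffCoeff u n q ((l + 1) % 2) m (l + 1)‖ := by
    refine le_trans ?_ (T.le_norm_birkhoffCoeff h2)
    have hkey : u m ≤ 4 * (m * (u (n (l + 1)) / n (l + 1))) := by
      rw [mul_div_assoc', mul_div_assoc', le_div_iff₀ hn]
      rcases le_total (m : ℝ) (n (l + 1)) with h | h
      · have := T.rate.mono (mem_Ici.2 hm0.le) (mem_Ici.2 hn.le) h
        nlinarith [T.one_le_u (l + 1)]
      · have := T.rate.mul_le_mul hn h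
        nlinarith [T.one_le_u (l + 1)]
    rw [← T.q_mul_amplitude] at hkey
    have hA := T.amplitude_pos (l + 1)
    have hpi : 1 / 2 ≤ 2 / Real.pi := by
      rw [div_le_div_iff₀ two_pos Real.pi_pos]; linarith [Real.pi_lt_four]
    calc (R / (2 * q (l + 1))) ^ 3 = u m / (8 * (q (l + 1) : ℝ) ^ 3) := by
          rw [div_pow, hR3]; ring
      _ ≤ u m / (8 * q (l + 1)) := by
          gcongr
          exact le_self_pow₀ hq1 three_ne_zero
      _ ≤ amplitude u n q (l + 1) * m * (1 / 2) := by
          rw [div_le_iff₀ (by positivity)]; linarith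
      _ ≤ amplitude u n q (l + 1) * m * (2 / Real.pi) := by gcongr
      _ = _ := by ring
  have hE := T.tsum_others_le (l := l) (m := m) (by omega)
  have hE2 : 7 * (n l : ℝ) ≤ (R / (2 * q (l + 1))) ^ 2 / 2 := by nlinarith
  refine (norm_integral_phase_trigSum_le T.one_le_q
    (T.summable_sq_mul_birkhoffCoeff ((l + 1) % 2) m) hs1 hdom (hE.trans hE2)).trans ?_
  -- The logarithm in the rate pays for the frequency: q_{l+1} ≤ n_l² ≤ log u(m).
  calc 5 / (R / (2 * q (l + 1))) = 10 * (q (l + 1) / R) := by field_simp; norm_num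
    _ ≤ 10 * (Real.log (u m) / R) := by
      gcongr
      nlinarith

end IsTower

/-! ### The diffeomorphism of a tower -/

/-- The skew product attached to a tower. -/
noncomputable def towerPerm (u : ℝ → ℝ) (n q : ℕ → ℕ) : Equiv.Perm (FlatTorus 3) :=
  skewPerm (recipSum q 0 : UnitAddCircle) (recipSum q 1 : UnitAddCircle) fun x y =>
    (trigSum_periodic_one (towerCoeff u n q 0) q).lift x +
      (trigSum_periodic_one (towerCoeff u n q 1) q).lift y

/-- The `m`-th Birkhoff sum of the part of the cocycle with frequencies of parity `p`. -/
noncomputable def birkhoffLift (u : ℝ → ℝ) (n q : ℕ → ℕ) (p m : ℕ) : UnitAddCircle → ℝ :=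
  (trigSum_periodic_one (birkhoffCoeff u n q p m) q).lift

namespace IsTower
variable {u : ℝ → ℝ} {n q : ℕ → ℕ} (T : IsTower u n q)
include T

theorem sum_lift_eq (p m : ℕ) (x : UnitAddCircle) :
    ∑ i ∈ Finset.range m, (trigSum_periodic_one (towerCoeff u n q p) q).lift
      (x + i • (recipSum q p : UnitAddCircle)) = birkhoffLift u n q p m x := by
  induction x using QuotientAddGroup.induction_on with | _ x => ?_
  refine Eq.trans (Finset.sum_congr rfl fun i _ => ?_)
    (sum_trigSum_rotation (T.summable_towerCoeff p) (recipSum q p) x m)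
  have : (x : UnitAddCircle) + i • (recipSum q p : UnitAddCircle) =
      ((x + i * recipSum q p : ℝ) : UnitAddCircle) := by
    rw [AddCircle.coe_add, ← AddCircle.coe_nsmul, nsmul_eq_mul]
  exact congrArg _ this

theorem towerPerm_pow (m : ℕ) : towerPerm u n q ^ m =
    skewPerm (m • (recipSum q 0 : UnitAddCircle)) (m • (recipSum q 1 : UnitAddCircle))
      fun x y => birkhoffLift u n q 0 m x + birkhoffLift u n q 1 m y := by
  rw [towerPerm, skewPerm_pow]
  congr 1
  funext x y
  rw [Finset.sum_add_distrib, T.sum_lift_eq, T.sum_lift_eq]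

/-! ### Growth of the iterates -/

theorem growth_towerPerm_pow_le {m : ℕ} {B : ℝ}
    (h : ∀ p, ∑' j, (q j : ℝ) * ‖birkhoffCoeff u n q p m j‖ ≤ B) :
    growth (towerPerm u n q ^ m) ≤ ENNReal.ofReal (1 + 16 * B) := by
  have hB : 0 ≤ B := (tsum_nonneg fun j => by positivity).trans (h 0)
  have hl : ∀ p (x y : UnitAddCircle), |birkhoffLift u n q p m x - birkhoffLift u n q p m y| ≤
      8 * B * ‖x - y‖ := fun p x y => by
    refine (abs_lift_sub_lift_le _ (abs_trigSum_sub_trigSum_le (T.summable_birkhoffCoeff p m)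
      (T.summable_q_mul_birkhoffCoeff p m)) x y).trans ?_
    refine mul_le_mul_of_nonneg_right ?_ (norm_nonneg _)
    have := Real.pi_lt_four
    have := Real.pi_pos
    calc 2 * Real.pi * _ ≤ 2 * Real.pi * B := mul_le_mul_of_nonneg_left (h p) (by positivity)
      _ ≤ 8 * B := by nlinarith
  rw [T.towerPerm_pow]
  refine (growth_skewPerm_le (by positivity) (by positivity) (hl 0) (hl 1)).trans ?_
  exact ENNReal.ofReal_le_ofReal (by linarith)

/-- The dominating term contributes 2π · (2m/π) · q A = 4m u(n_{l+1})/n_{l+1} to the derivative; the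
other terms cost at most 2π · 7 n_l ≤ 56 n_l. -/
theorem growth_towerPerm_pow_ge {l m : ℕ} (hm : 4 * m ≤ n (l + 2)) :
    ENNReal.ofReal (4 * (m * (u (n (l + 1)) / n (l + 1))) - 56 * n l) ≤
      growth (towerPerm u n q ^ m) := by
  set p := (l + 1) % 2
  obtain ⟨x, hx⟩ := exists_abs_trigSum_deriv_ge (q := q) (T.summable_q_mul_birkhoffCoeff p m)
    (k := l + 1) (T.one_le_q _)
  have hd := hasDerivAt_trigSum (T.summable_birkhoffCoeff p m)
    (T.summable_q_mul_birkhoffCoeff p m) x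
  set d := trigSum (fun j => Complex.I * ((2 * Real.pi * q j : ℝ) : ℂ) *
    birkhoffCoeff u n q p m j) q x
  have hpi := Real.pi_pos
  have hdom : 4 * (m * (u (n (l + 1)) / n (l + 1))) ≤
      2 * Real.pi * (q (l + 1) * ‖birkhoffCoeff u n q p m (l + 1)‖) := by
    have h1 := T.le_norm_birkhoffCoeff hm
    rw [← T.q_mul_amplitude]
    have hq := T.q_pos (l + 1)
    calc 4 * (m * (q (l + 1) * amplitude u n q (l + 1)))
        = 2 * Real.pi * (q (l + 1) * (amplitude u n q (l + 1) * (2 * m / Real.pi))) := by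
          field_simp; ring
      _ ≤ _ := by gcongr
  have hoth : ∑' j, (if j = l + 1 then 0 else (q j : ℝ) * ‖birkhoffCoeff u n q p m j‖) ≤ 7 * n l :=
    (tsum_ite_le_of_le (fun j => by positivity)
      (fun j => T.q_mul_le_sq_mul j (norm_nonneg _)) (T.summable_sq_mul_birkhoffCoeff p m) _).trans
      (T.tsum_others_le (by omega))
  have hle : 4 * (m * (u (n (l + 1)) / n (l + 1))) - 56 * n l ≤ |d| := by
    refine le_trans ?_ hx
    rw [mul_sub]
    have : 2 * Real.pi * ∑' j, (if j = l + 1 then 0 else (q j : ℝ) * ‖birkhoffCoeff u n q p m j‖) ≤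
        56 * n l := by
      calc _ ≤ 2 * Real.pi * (7 * n l) := by gcongr
        _ ≤ 56 * n l := by nlinarith [Real.pi_lt_four, T.n_pos l]
    linarith
  refine (ENNReal.ofReal_le_ofReal hle).trans ?_
  rw [T.towerPerm_pow]
  rcases Nat.mod_two_eq_zero_or_one (l + 1) with h | h
  · refine ofReal_abs_deriv_le_growth_left (y := 0) (s := x) ?_
    have h2 : HasDerivAt (trigSum (birkhoffCoeff u n q 0 m) q) d x := by rw [← h]; exact hd
    exact h2.add_const _
  · refine ofReal_abs_deriv_le_growth_right (x := 0) (s := x) ?_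
    have h2 : HasDerivAt (trigSum (birkhoffCoeff u n q 1 m) q) d x := by rw [← h]; exact hd
    exact h2.const_add _

theorem one_le_growth (m : ℕ) : 1 ≤ growth (towerPerm u n q ^ m) := by
  rw [T.towerPerm_pow]; exact one_le_growth_skewPerm _ _ _

theorem frequently_growth_le : ∃ c₁ : ℝ, 0 < c₁ ∧
    ∃ᶠ m : ℕ in atTop, growth (towerPerm u n q ^ m) ≤ ENNReal.ofReal (c₁ * u m) := by
  refine ⟨369, by norm_num, Filter.frequently_atTop.2 fun a => ⟨n (a + 1), ?_, ?_⟩⟩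
  · exact (Nat.le_succ a).trans (T.strictMono_n.id_le _)
  · refine (T.growth_towerPerm_pow_le fun p => T.tsum_at_n_le p a).trans ?_
    exact ENNReal.ofReal_le_ofReal (by linarith [T.one_le_u (a + 1)])

theorem frequently_maxGrowth_le : ∃ c₃ : ℝ, 0 < c₃ ∧
    ∃ᶠ m : ℕ in atTop,
      maxGrowth (towerPerm u n q) m ≤ ENNReal.ofReal (c₃ * (u (√(m : ℝ)) * √(m : ℝ))) := by
  refine ⟨177, by norm_num, Filter.frequently_atTop.2 fun a => ⟨n a ^ 2, ?_, ?_⟩⟩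
  · exact (T.strictMono_n.id_le a).trans (Nat.le_self_pow two_ne_zero _)
  · rw [Nat.cast_pow, Real.sqrt_sq (T.n_pos a).le]
    refine Finset.sup_le fun i hi => ?_
    refine (T.growth_towerPerm_pow_le fun p =>
      T.tsum_le_of_le_sq p (Finset.mem_Icc.1 hi).2).trans ?_
    refine ENNReal.ofReal_le_ofReal ?_
    have : 1 ≤ u (n a) * n a := one_le_mul_of_one_le_of_one_le (T.one_le_u a)
      (by linarith [T.hundred_le_n a])
    linarith

omit T in
theorem le_maxGrowth {φ : Equiv.Perm (FlatTorus 3)} {m N : ℕ} (h1 : 1 ≤ m) (h2 : m ≤ N) :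
    growth (φ ^ m) ≤ maxGrowth φ N :=
  Finset.le_sup (f := fun i => growth (φ ^ i)) (Finset.mem_Icc.2 ⟨h1, h2⟩)

theorem sqrt_div_log_le_maxGrowth {N : ℕ} (hN : n 2 ≤ N) :
    ENNReal.ofReal (√(N : ℝ) / Real.log (u N)) ≤ maxGrowth (towerPerm u n q) N := by
  have hw := T.exists_window (M := N) ((T.strictMono_n.monotone one_le_two).trans hN)
  obtain ⟨l', h1, h2⟩ := hw
  obtain ⟨l, rfl⟩ : ∃ l, l' = l + 1 := by
    rcases l' with _ | l
    · simp only [zero_add] at h2; omega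
    · exact ⟨l, rfl⟩
  have e2 : l + 1 + 1 = l + 2 := rfl
  have e3 : l + 1 + 2 = l + 3 := rfl
  rw [e2] at h1
  rw [e3] at h2
  have ha := T.hundred_le_n l
  have hb : 100 * (n l : ℝ) ^ 2 ≤ n (l + 1) := T.sq_le_n_succ l
  have hc : 100 * (n (l + 1) : ℝ) ^ 2 ≤ n (l + 2) := T.sq_le_n_succ (l + 1)
  have hb0 := T.n_pos (l + 1)
  have hc0 := T.n_pos (l + 2)
  have hN1 : (n (l + 2) : ℝ) ≤ N := by exact_mod_cast h1
  have hN0 : (0 : ℝ) < N := by linarith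
  have hb100 := T.hundred_le_n (l + 1)
  have hc100 := T.hundred_le_n (l + 2)
  have hlog : 99 * (n (l + 1) : ℝ) ^ 2 ≤ Real.log (u N) := T.log_u_ge (l := l + 1) (by
    rw [e2]; omega)
  have hlog0 : 0 < Real.log (u N) := lt_of_lt_of_le (by positivity) hlog
  -- If N ≤ n_{l+2}², the time n_{l+2}/4 suffices: term l + 1 has derivative of order at least
  -- n_{l+2}/n_{l+1}, and log u(N) ≥ 99 n_{l+1}² covers the loss. Otherwise term l + 2 at time N/4
  -- has derivative of order at least N/n_{l+2} ≥ √N.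
  rcases le_total N (n (l + 2) ^ 2) with hcase | hcase
  · have hm4 : 4 * (n (l + 2) / 4) ≤ n (l + 2) := Nat.mul_div_le _ _
    have hm3 : n (l + 2) ≤ 4 * (n (l + 2) / 4) + 3 := by omega
    set m := n (l + 2) / 4
    have hm1 : 1 ≤ m := by
      have : 100 ≤ n (l + 2) := by exact_mod_cast hc100
      omega
    refine le_trans ?_ ((T.growth_towerPerm_pow_ge hm4).trans (le_maxGrowth hm1 (by omega)))
    refine ENNReal.ofReal_le_ofReal ?_
    have hm3' : (n (l + 2) : ℝ) ≤ 4 * m + 3 := by exact_mod_cast hm3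
    have hsq : √(N : ℝ) ≤ n (l + 2) := by
      rw [Real.sqrt_le_left hc0.le]
      exact_mod_cast hcase
    set a := (n l : ℝ)
    set b := (n (l + 1) : ℝ)
    set c := (n (l + 2) : ℝ)
    have hub : 1 / b ≤ u b / b := div_le_div_of_nonneg_right (T.one_le_u (l + 1)) hb0.le
    calc √(N : ℝ) / Real.log (u N) ≤ c / (99 * b ^ 2) := by gcongr
      _ ≤ (c - 3) / b - 56 * a := by
        rw [div_le_iff₀ (by positivity)]
        have : ((c - 3) / b - 56 * a) * (99 * b ^ 2) = 99 * b * (c - 3) - 56 * 99 * a * b ^ 2 := by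
          field_simp
        rw [this]
        have h5 : 56 * a ≤ b := by nlinarith
        have h6 : 56 * 99 * a * b ^ 2 ≤ 99 * b * (c / 100) := by
          calc 56 * 99 * a * b ^ 2 = 99 * (56 * a) * b ^ 2 := by ring
            _ ≤ 99 * b * b ^ 2 := by gcongr
            _ ≤ 99 * b * (c / 100) := by gcongr; linarith
        nlinarith
      _ ≤ 4 * (m * (u b / b)) - 56 * a := by
        have h7 : (0 : ℝ) ≤ m := Nat.cast_nonneg _
        have : (c - 3) / b ≤ 4 * (m * (1 / b)) := by
          rw [div_le_iff₀ hb0]; field_simp; linarith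
        have h8 := mul_le_mul_of_nonneg_left hub h7
        linarith
  · have hm4 : 4 * (N / 4) ≤ n (l + 1 + 2) := (Nat.mul_div_le _ _).trans (by rw [e3]; omega)
    have hm3 : N ≤ 4 * (N / 4) + 3 := by omega
    have hm2 : N / 4 ≤ N := Nat.div_le_self _ _
    have hm1 : 1 ≤ N / 4 := by
      have : 100 ≤ n (l + 2) := by exact_mod_cast hc100
      omega
    set m := N / 4
    refine le_trans ?_ ((T.growth_towerPerm_pow_ge hm4).trans (le_maxGrowth hm1 hm2))
    refine ENNReal.ofReal_le_ofReal ?_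
    rw [e2]
    have hm3' : (N : ℝ) ≤ 4 * m + 3 := by exact_mod_cast hm3
    have hsq : (n (l + 2) : ℝ) ≤ √(N : ℝ) := by
      refine Real.le_sqrt_of_sq_le ?_
      exact_mod_cast hcase
    have hs2 : √(N : ℝ) * √(N : ℝ) = N := Real.mul_self_sqrt hN0.le
    set b := (n (l + 1) : ℝ)
    set c := (n (l + 2) : ℝ)
    set t := √(N : ℝ)
    have hub : 1 / c ≤ u c / c := div_le_div_of_nonneg_right (T.one_le_u (l + 2)) hc0.le
    have h9 : 56 * b ≤ t / 4 := by nlinarith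
    calc t / Real.log (u N) ≤ t / 2 := by
          gcongr
          nlinarith
      _ ≤ (N - 3) / c - 56 * b := by
        have : t - 1 ≤ (N - 3) / c := by
          rw [le_div_iff₀ hc0]; nlinarith
        linarith
      _ ≤ 4 * (m * (u c / c)) - 56 * b := by
        have h7 : (0 : ℝ) ≤ m := Nat.cast_nonneg _
        have : ((N : ℝ) - 3) / c ≤ 4 * (m * (1 / c)) := by
          rw [div_le_iff₀ hc0]; field_simp; linarith
        have h8 := mul_le_mul_of_nonneg_left hub h7
        linarith

theorem le_maxGrowth_all : ∃ c₂ : ℝ, 0 < c₂ ∧ ∀ N : ℕ, 2 ≤ N →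
    ENNReal.ofReal (c₂ * (√(N : ℝ) / Real.log (u N))) ≤ maxGrowth (towerPerm u n q) N := by
  have hlog : ∀ N : ℕ, 2 ≤ N → 0 < Real.log (u N) := fun N hN =>
    Real.log_pos (T.rate.one_lt (by exact_mod_cast hN))
  -- Below `n 2` the comparison is with 1, which bounds the growth of every iterate from below.
  obtain ⟨C, hC, h⟩ := exists_const_mul_bound (f := fun N : ℕ => √(N : ℝ) / Real.log (u N))
    (r := fun N => if N < n 2 then 1 else √(N : ℝ) / Real.log (u N)) (M := n 2) (C := 1)
    (fun N hN => by
      have := hlog N hN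
      have : (0 : ℝ) < N := by positivity
      split_ifs <;> positivity)
    (fun N hN _ => by rw [if_neg (not_lt.2 hN), one_mul])
  refine ⟨C⁻¹, inv_pos.2 hC, fun N hN => ?_⟩
  have h1 := h N hN
  rw [← div_le_iff₀' hC, div_eq_inv_mul] at h1
  refine (ENNReal.ofReal_le_ofReal h1).trans ?_
  split_ifs with hlt
  · rw [ENNReal.ofReal_one]
    exact (T.one_le_growth N).trans (le_maxGrowth (by omega) le_rfl)
  · exact T.sqrt_div_log_le_maxGrowth (not_lt.1 hlt)

/-! ### Mixing of the observable -/

theorem continuous_birkhoffLift (p m : ℕ) : Continuous (birkhoffLift u n q p m) :=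
  continuous_lift _ (continuous_trigSum (T.summable_birkhoffCoeff p m))

theorem birkhoffLift_add_third (p m : ℕ) (x : UnitAddCircle) :
    birkhoffLift u n q p m (x + ((1 / 3 : ℝ) : UnitAddCircle)) = birkhoffLift u n q p m x := by
  induction x using QuotientAddGroup.induction_on with | _ x => ?_
  refine trigSum_periodic (birkhoffCoeff u n q p m) (m := 1 / 3) (fun j => ?_) x
  obtain ⟨k, hk⟩ := T.three_dvd_q j
  exact ⟨k, by rw [hk]; push_cast; ring⟩

theorem abs_integral_observable_le (ε A : ℝ) (m : ℕ) :
    |∫ p, observable ε A ((towerPerm u n q ^ m) p) * observable ε A p ∂torusMeasure 3| ≤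
      ε ^ 2 / 2 * |A ^ 2 + Real.cos (2 * Real.pi * (m * recipSum q 0))| *
        (‖∫ x in (0 : ℝ)..1, phase (trigSum (birkhoffCoeff u n q 0 m) q x)‖ *
          ‖∫ x in (0 : ℝ)..1, phase (trigSum (birkhoffCoeff u n q 1 m) q x)‖) := by
  rw [T.towerPerm_pow, integral_observable_comp_mul (T.continuous_birkhoffLift 0 m)
    (T.continuous_birkhoffLift 1 m) (T.birkhoffLift_add_third 0 m)]
  have e : ∀ p, ∫ x : UnitAddCircle, circleExp (birkhoffLift u n q p m x : UnitAddCircle) =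
      ∫ x in (0 : ℝ)..1, phase (trigSum (birkhoffCoeff u n q p m) q x) := fun p =>
    integral_circleExp_lift _
  rw [e, e, abs_mul, abs_of_nonneg (by positivity : 0 ≤ ε ^ 2 / 2), mul_assoc (ε ^ 2 / 2)]
  refine mul_le_mul_of_nonneg_left ((Complex.abs_re_le_norm _).trans (le_of_eq ?_)) (by positivity)
  rw [norm_mul, norm_mul, Complex.norm_real, Real.norm_eq_abs, ← AddCircle.coe_nsmul,
    circleExp_coe, phase_re, nsmul_eq_mul, mul_assoc]

omit T in
theorem norm_integral_phase_le_one (p m : ℕ) :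
    ‖∫ x in (0 : ℝ)..1, phase (trigSum (birkhoffCoeff u n q p m) q x)‖ ≤ 1 := by
  rw [← integral_circleExp_lift (trigSum_periodic_one _ _)]
  exact norm_integral_circleExp_le_one _

theorem exists_mixesAtRate : ∃ f : FlatTorus 3 → ℝ, f ≠ 0 ∧ IsAnalyticFun f ∧
    MixesAtRate (torusMeasure 3) (towerPerm u n q) f
      (fun m : ℕ => Real.log (u m) / u m ^ (1 / 3 : ℝ)) := by
  set r : ℕ → ℝ := fun m => Real.log (u m) / u m ^ (1 / 3 : ℝ)
  set I : ℕ → ℕ → ℝ := fun p m =>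
    ‖∫ x in (0 : ℝ)..1, phase (trigSum (birkhoffCoeff u n q p m) q x)‖
  have hr : ∀ m : ℕ, 2 ≤ m → 0 < r m := fun m hm => by
    have h := T.rate.one_lt (x := m) (by exact_mod_cast hm)
    have := Real.log_pos h
    have : 0 < u m := by linarith
    positivity
  have hI0 : ∀ p m, 0 ≤ I p m := fun p m => norm_nonneg _
  have hI1 : ∀ p m, I p m ≤ 1 := fun p m => norm_integral_phase_le_one p m
  obtain ⟨C, hC, hCr⟩ := exists_const_mul_bound (f := fun m => I 0 m * I 1 m) hr (M := n 1) (C := 10)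
    (fun m hm _ => by
      -- The window of 4m decides which of the two integrals is small; the other is bounded by 1.
      obtain ⟨l, h1, h2⟩ := T.exists_window (M := 4 * m) (by omega)
      have h := T.norm_integral_phase_birkhoff_le h1 h2.le
      change I ((l + 1) % 2) m ≤ 10 * r m at h
      refine le_trans ?_ h
      rcases Nat.mod_two_eq_zero_or_one (l + 1) with hp | hp
      · rw [hp]; exact mul_le_of_le_one_right (hI0 0 m) (hI1 1 m)
      · rw [hp]; exact mul_le_of_le_one_left (hI0 1 m) (hI1 0 m))
  have hcos := T.cos_recipSum_neg
  set A := √(-Real.cos (2 * Real.pi * recipSum q 0))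
  have hA : A ^ 2 = -Real.cos (2 * Real.pi * recipSum q 0) := Real.sq_sqrt (by linarith)
  -- Correlations are quadratic in the observable, so this scaling cancels `C`.
  set ε := (√C)⁻¹
  have hε : ε ^ 2 * C = 1 := by
    simp only [ε]
    rw [inv_pow, Real.sq_sqrt hC.le, inv_mul_cancel₀ hC.ne']
  have hε0 : ε ≠ 0 := by simp only [ε]; positivity
  refine ⟨observable ε A, observable_ne_zero hε0 (Real.sqrt_nonneg _), isAnalyticFun_observable ε A,
    lipschitz_observable ε A, integral_observable ε A, ?_, fun m hm => ?_⟩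
  · have h1 : Tendsto (fun x : ℝ => Real.log x / x ^ (1 / 3 : ℝ)) atTop (𝓝 0) :=
      (isLittleO_log_rpow_atTop (by norm_num)).tendsto_div_nhds_zero
    exact h1.comp (T.rate.tendsto.comp tendsto_natCast_atTop_atTop)
  · refine (T.abs_integral_observable_le ε A m).trans ?_
    -- At time 1 both sides vanish: u(1) = 1, and A² was chosen to cancel the cosine.
    rcases Nat.eq_or_lt_of_le hm with rfl | hm
    · rw [Nat.cast_one, one_mul, hA, neg_add_cancel, abs_zero, mul_zero, zero_mul]
      simp only [r, Nat.cast_one, T.rate.eq_one, Real.log_one, zero_div, le_refl]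
    · have hA2 : |A ^ 2 + Real.cos (2 * Real.pi * (m * recipSum q 0))| ≤ 2 := by
        rw [hA, abs_le]
        have h1 := Real.neg_one_le_cos (2 * Real.pi * recipSum q 0)
        have h2 := Real.cos_le_one (2 * Real.pi * recipSum q 0)
        have h3 := Real.neg_one_le_cos (2 * Real.pi * (m * recipSum q 0))
        have h4 := Real.cos_le_one (2 * Real.pi * (m * recipSum q 0))
        constructor <;> linarith
      have h5 := hCr m hm
      have h6 : 0 ≤ I 0 m * I 1 m := mul_nonneg (hI0 0 m) (hI0 1 m)
      calc _ ≤ ε ^ 2 / 2 * 2 * (C * r m) := by gcongr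
        _ = ε ^ 2 * C * r m := by ring
        _ = r m := by rw [hε, one_mul]

end IsTower

theorem mainTheorem6 (u : ℝ → ℝ)
    (hu_nonneg : ∀ x : ℝ, 0 ≤ x → 0 ≤ u x)
    (hu_concave : ConcaveOn ℝ (Ici (0 : ℝ)) u)
    (hu_mono : MonotoneOn u (Ici (0 : ℝ)))
    (hu_tendsto : Tendsto u atTop atTop)
    (hu_one : 1 ≤ u 1)
    (hu_le : ∀ x : ℝ, 1 ≤ x → u x ≤ x ^ (3 / 4 : ℝ)) :
    ∃ φ : Equiv.Perm (FlatTorus 3),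
      IsAnalyticDiffeo φ ∧
      MeasurePreserving φ (torusMeasure 3) (torusMeasure 3) ∧
      IsSkewProduct φ ∧
      (∃ f : FlatTorus 3 → ℝ, f ≠ 0 ∧ IsAnalyticFun f ∧
        MixesAtRate (torusMeasure 3) φ f
          (fun n : ℕ => Real.log (u n) / (u n) ^ (1 / 3 : ℝ))) ∧
      (∃ c₁ : ℝ, 0 < c₁ ∧
        ∃ᶠ n : ℕ in atTop, growth (φ ^ n) ≤ ENNReal.ofReal (c₁ * u n)) ∧
      (∃ c₂ c₃ : ℝ, 0 < c₂ ∧ 0 < c₃ ∧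
        (∀ n : ℕ, 2 ≤ n →
          ENNReal.ofReal (c₂ * (√(n : ℝ) / Real.log (u n))) ≤ maxGrowth φ n) ∧
        (∃ᶠ n : ℕ in atTop,
          maxGrowth φ n ≤ ENNReal.ofReal (c₃ * (u (√(n : ℝ)) * √(n : ℝ))))) := by
  obtain ⟨n, q, T⟩ := exists_isTower
    (⟨hu_nonneg, hu_concave, hu_mono, hu_tendsto, hu_one, hu_le⟩ : IsRate u)
  have hX := analyticOnNhd_trigSum (T.summable_towerCoeff_mul_exp 0)
  have hY := analyticOnNhd_trigSum (T.summable_towerCoeff_mul_exp 1)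
  obtain ⟨c₂, hc₂, h₂⟩ := T.le_maxGrowth_all
  obtain ⟨c₃, hc₃, h₃⟩ := T.frequently_maxGrowth_le
  refine ⟨towerPerm u n q, isAnalyticDiffeo_skewPerm _ _ _ _ hX hY, measurePreserving_skewPerm _ _ ?_,
    isSkewProduct_skewPerm _ _ _ _ hX hY, T.exists_mixesAtRate, T.frequently_growth_le,
    c₂, c₃, hc₂, hc₃, h₂, h₃⟩
  exact ((continuous_lift _ (continuous_trigSum (T.summable_towerCoeff 0))).comp continuous_fst).add
    ((continuous_lift _ (continuous_trigSum (T.summable_towerCoeff 1))).comp continuous_snd)
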